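/- **Setting.** Let $\mathcal X\subseteq\mathbb R^k$ and let $\mathcal C\subseteq\mathbb R^d$ be bounded; let $\mathcal D$ be a probability distribution of $(x,c)\in\mathcal X\times\mathcal C$, $\|\cdot\|$ a norm on $\mathbb R^d$, $S\subseteq\mathbb R^d$ a polyhedron, and $w^*:\mathbb R^d\to S$ an oracle such that $w^*(\hat c)$ minimizes $\hat c^Tw$ over $w\in S$, for every $\hat c\in\mathbb R^d$. Put $\ell_{\rm SPO}(\hat c,c)=c^Tw^*(\hat c)-c^Tw^*(c)$ and $\omega_S(\mathcal C)=\sup_{c\in\mathcal C}\{\max_{w\in S}c^Tw-\min_{w\in S}c^Tw\}$. Let $\nu_S(\hat c)$ be the distance in $\|\cdot\|$ from $\hat c$ to the set of vectors $c$ for which $\min_{w\in S}c^Tw$ has more than one minimizer ($+\infty$ if there are none). Let $\mathcal H$ be a class of functions $\mathcal X\to\mathbb R^d$, compact for the sup norm, and let $\ell:\mathbb R^d\times\mathbb R^d\to[0,\infty)$ be a surrogate loss such that $\omega_\ell:=\sup\{\ell(h(x),c):h\in\mathcal H,\ x\in\mathcal X,\ c\in\mathcal C\}$ is finite. All sets and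 functions are Borel. For a loss $\lambda\in\{\ell,\ell_{\rm SPO}\}$ put $R_\lambda(h)=\mathbb E\,\lambda(h(x),c)$ and $R_\lambda^*=\inf_{h\in\mathcal H}R_\lambda(h)$, and let $\mathcal H^*_\ell$ and $\mathcal H^*$ be the sets of minimizers over $\mathcal H$ of $R_\ell$ and of $R_{\rm SPO}:=R_{\ell_{\rm SPO}}$. Put $\Psi(b)=\mathbb P(\inf_{h\in\mathcal H^*}\nu_S(h(x))\le b)$. **Assumptions.** $\mathcal H^*_\ell$ is nonempty and $\mathcal H^*_\ell\subseteq\mathcal H^*$. There is a non-decreasing $\phi:[0,\infty)\to[0,\infty)$ with $\phi(0)=0$ and $\phi(\epsilon)=O(\sqrt\epsilon)$ as $\epsilon\downarrow0$ such that, for all $h\in\mathcal H$ and $\epsilon>0$, $R_\ell(h)-R_\ell^*\le\epsilon$ implies $\inf_{g\in\mathcal H^*_\ell}\|h-g\|_\infty\le\phi(\epsilon)$, where $\|\cdot\|_\infty$ is the essential sup norm with respect to the distribution of $x$. **Algorithm.** Let $\tilde p,\delta\in(0,1]$, $n_0\ge1$ and $b_0>0$ be given, and put $b_t=b_0\,(n_0\ln(n_0+t)/t)^{1/4}$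 for $t\ge1$. Samples are i.i.d. from $\mathcal D$. All $n_0$ warm-up samples are labeled. At iteration $t\ge1$ the feature $x_t$ is observed. If $\nu_S(h_{t-1}(x_t))<b_{t-1}$, put $d_t=1$ and acquire the label $c_t$. Otherwise put $d_t=0$ and acquire $c_t$ if and only if an independent coin $q_t\in\{0,1\}$, with $\mathbb P(q_t=1)=\tilde p$, shows $1$. For $t\ge0$, $h_t\in\mathcal H$ minimizes over $\mathcal H$ the sum of the losses $\ell(h(x),c)$ of the warm-up samples and of the re-weighted losses $\ell^{\rm rew}(h;z_s)$, $s\le t$, where, for $z=(x,c,d,q)$, $\ell^{\rm rew}(h;z)=d\,\ell(h(x),c)+(1-d)\frac q{\tilde p}\ell(h(x),c)$; ties are broken without knowledge of future samples. Let $n_T$ be the number of labels acquired in iterations $1,\dots,T$ (without the warm-up labels). **Covering numbers.** Let $\mathcal Z=\mathcal X\times\mathcal C\times\{0,1\}^2$. An $A$-valued tree $v$ of depth $n$ is a complete binary tree whose nodes carry labels in $A$; $v_i(\sigma)$ is the label of its $i$-th node along the path $\sigma\in\{\pm1\}^n$. Let $N_1(\alpha,n)$ be the supremum, over all $\mathcal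 Z$-valued trees $\mathbf z$ of depth $n$, of the least cardinality of a set $V$ of real-valued trees of depth $n$ such that for all $h\in\mathcal H$ and all $\sigma$ some $v\in V$ satisfies $\sum_{i=1}^n|v_i(\sigma)-\ell^{\rm rew}(h;\mathbf z_i(\sigma))|\le n\alpha$. Write $N(n)=N_1(\omega_\ell/n,n)$, assume that $N(n)<\infty$ for all $n\ge n_0$, and, for $t\ge0$ and $n=t+n_0$, put $$r_t=2\omega_\ell\Big[\frac1{\tilde p}\sqrt{\frac{4\ln(2n\,N(n)/\delta)}{n}}+\frac2n\Big],\qquad \rho_t=2\omega_\ell\Big[\frac1{\tilde p}\sqrt{\frac{2\ln(2N(n)/\delta)}{n}}+\frac2n\Big].$$ **Theorem 2.** (0) If $\ln N(n)=O(\ln(n+1))$, then for all sufficiently large $b_0$ it holds that $b_t\ge2\phi(r_t)$ for all $t\ge0$. Suppose that $b_0>0$ is such that $b_t\ge2\phi(r_t)$ for all $t\ge0$. Then, with probability at least $1-\delta$, simultaneously for all $T\ge1$: (a) $R_\ell(h_T)-R_\ell^*\le r_T$; (b) $R_{\rm SPO}(h_T)-R_{\rm SPO}^*\le\Psi(2b_T)\,\omega_S(\mathcal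 C)$. Moreover, deterministically, for all $T\ge1$: (c) $\mathbb E[n_T]\le\tilde pT+\sum_{t=1}^T\Psi(2b_{t-1})+\delta T$. If only $b_t\ge2\phi(\rho_t)$ for all $t\ge0$, then for each fixed $T\ge1$ the bounds (a), with $\rho_T$ in place of $r_T$, and (b) hold with probability at least $1-\delta$, and (c) holds for all $T\ge1$. -/

import Mathlib

open MeasureTheory ProbabilityTheory Filter Topology
open scoped ENNReal UniformConvergence

namespace MBAL

noncomputable section

/-! ### The downstream linear optimization problem -/

/-- A polyhedron: the solution set of finitely many linear inequalities. -/
def IsPolyhedron {d : ℕ} (S : Set (Fin d → ℝ)) : Prop :=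
  ∃ (m : ℕ) (A : Fin m → Fin d → ℝ) (β : Fin m → ℝ), S = {w | ∀ j, A j ⬝ᵥ w ≤ β j}

/-- The optimal solutions of `P(c) : min_{w ∈ S} cᵀ w`. -/
def optimalSolutions {d : ℕ} (S : Set (Fin d → ℝ)) (c : Fin d → ℝ) : Set (Fin d → ℝ) :=
  {w | w ∈ S ∧ ∀ w' ∈ S, c ⬝ᵥ w ≤ c ⬝ᵥ w'}

/-- The degenerate cost vectors: those `c` for which `P(c)` has multiple optimal solutions. -/
def degenerateSet {d : ℕ} (S : Set (Fin d → ℝ)) : Set (Fin d → ℝ) :=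
  {c | (optimalSolutions S c).Nontrivial}

/-- Distance to degeneracy with respect to the norm `N`
(it is `∞` if there is no degenerate cost vector). -/
def distDegeneracy {d : ℕ} (N : Seminorm ℝ (Fin d → ℝ)) (S : Set (Fin d → ℝ))
    (c : Fin d → ℝ) : ℝ≥0∞ :=
  ⨅ c' ∈ degenerateSet S, ENNReal.ofReal (N (c' - c))

/-- The linear optimization gap `max_{w ∈ S} cᵀ w - min_{w ∈ S} cᵀ w`. -/
def linGap {d : ℕ} (S : Set (Fin d → ℝ)) (c : Fin d → ℝ) : ℝ :=
  sSup ((fun w => c ⬝ᵥ w) '' S) - sInf ((fun w => c ⬝ᵥ w) '' S)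

/-- `ω_S(𝒞)`, the supremum of the linear optimization gap over the cost vectors in `𝒞`. -/
def linGapSup {d : ℕ} (S C : Set (Fin d → ℝ)) : ℝ := sSup (linGap S '' C)

/-- The SPO loss for the optimization oracle `w`. -/
def spoLoss {d : ℕ} (w : (Fin d → ℝ) → (Fin d → ℝ)) (chat c : Fin d → ℝ) : ℝ :=
  c ⬝ᵥ w chat - c ⬝ᵥ w c

/-! ### Predictors and risks -/

/-- Predictors: functions from the feature space `X ⊆ ℝᵏ` to `ℝᵈ`. -/
abbrev Predictor {k : ℕ} (X : Set (Fin k → ℝ)) (d : ℕ) : Type := X → (Fin d → ℝ)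

/-- The range `{h(x) : h ∈ H, x ∈ X}` of the predictions. -/
def predictionSpace {k d : ℕ} {X : Set (Fin k → ℝ)} (H : Set (Predictor X d)) :
    Set (Fin d → ℝ) :=
  {v | ∃ h ∈ H, ∃ x : X, h x = v}

/-- `ω_ℓ`, the supremum of the loss over predictions in `A` and cost vectors in `C`. -/
def lossSup {d : ℕ} (l : (Fin d → ℝ) → (Fin d → ℝ) → ℝ) (A C : Set (Fin d → ℝ)) : ℝ :=
  sSup (Set.image2 l A C)

/-- The risk `E[ℓ(h(x), c)]`. -/
def risk {k d : ℕ} {X : Set (Fin k → ℝ)} {C : Set (Fin d → ℝ)} (D : Measure (X × C))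
    (l : (Fin d → ℝ) → (Fin d → ℝ) → ℝ) (h : Predictor X d) : ℝ :=
  ∫ z, l (h z.1) (z.2 : Fin d → ℝ) ∂D

/-- The optimal risk over the hypothesis class. -/
def optRisk {k d : ℕ} {X : Set (Fin k → ℝ)} {C : Set (Fin d → ℝ)} (D : Measure (X × C))
    (l : (Fin d → ℝ) → (Fin d → ℝ) → ℝ) (H : Set (Predictor X d)) : ℝ :=
  sInf (risk D l '' H)

/-- The predictors in the hypothesis class that minimize the risk. -/
def minimizers {k d : ℕ} {X : Set (Fin k → ℝ)} {C : Set (Fin d → ℝ)} (D : Measure (X × C))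
    (l : (Fin d → ℝ) → (Fin d → ℝ) → ℝ) (H : Set (Predictor X d)) : Set (Predictor X d) :=
  {h | h ∈ H ∧ ∀ g ∈ H, risk D l h ≤ risk D l g}

/-- The essential sup norm, with respect to the marginal distribution of the feature. -/
def essSupNorm {k d : ℕ} {X : Set (Fin k → ℝ)} {C : Set (Fin d → ℝ)}
    (N : Seminorm ℝ (Fin d → ℝ)) (D : Measure (X × C)) (f : Predictor X d) : ℝ≥0∞ :=
  essSup (fun x => ENNReal.ofReal (N (f x))) (D.map Prod.fst)

/-- The distance of the predictor `h` to the set `H'` in the essential sup norm. -/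
def distTo {k d : ℕ} {X : Set (Fin k → ℝ)} {C : Set (Fin d → ℝ)}
    (N : Seminorm ℝ (Fin d → ℝ)) (D : Measure (X × C)) (H' : Set (Predictor X d))
    (h : Predictor X d) : ℝ≥0∞ :=
  ⨅ g ∈ H', essSupNorm N D (h - g)

/-- The near-degeneracy function `Ψ(b) = P(inf_{h ∈ H'} ν_S(h(x)) ≤ b)`. -/
def nearDegeneracy {k d : ℕ} {X : Set (Fin k → ℝ)} {C : Set (Fin d → ℝ)}
    (N : Seminorm ℝ (Fin d → ℝ)) (S : Set (Fin d → ℝ)) (D : Measure (X × C))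
    (H' : Set (Predictor X d)) (b : ℝ) : ℝ :=
  (D.map Prod.fst).real {x | (⨅ h ∈ H', distDegeneracy N S (h x)) ≤ ENNReal.ofReal b}

/-! ### Sequential covering numbers -/

/-- An `A`-valued complete binary tree of depth `n`: the labelling function of level `t` maps the
path of length `t` that leads to a node to the label of that node (levels are `0, …, n - 1`). -/
abbrev Tree (A : Type) (n : ℕ) : Type := (t : Fin n) → (Fin t → Bool) → A

/-- The label of the level `t` node on the path `σ`. -/
def Tree.along {A : Type} {n : ℕ} (z : Tree A n) (σ : Fin n → Bool) (t : Fin n) : A :=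
  z t (fun i => σ ⟨i, i.2.trans t.2⟩)

/-- `V` is a sequential `α`-cover, in the `ℓ₁` sense, of the class `H` with the loss `L` on the
tree `z`. -/
def IsSeqCover {P Z : Type} (L : P → Z → ℝ) (H : Set P) (α : ℝ) {n : ℕ} (z : Tree Z n)
    (V : Set (Tree ℝ n)) : Prop :=
  ∀ h ∈ H, ∀ σ : Fin n → Bool, ∃ v ∈ V,
    ∑ t : Fin n, |v.along σ t - L h (z.along σ t)| ≤ n * α

/-- The least cardinality of a sequential `α`-cover on the tree `z`. -/
def seqCoverNumberOn {P Z : Type} (L : P → Z → ℝ) (H : Set P) (α : ℝ) {n : ℕ}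
    (z : Tree Z n) : ℕ∞ :=
  ⨅ (V : Set (Tree ℝ n)) (_ : IsSeqCover L H α z V), V.encard

/-- The sequential covering number `N₁(α, L ∘ H, n)`: the supremum over all trees of depth `n`. -/
def seqCoverNumber {P Z : Type} (L : P → Z → ℝ) (H : Set P) (α : ℝ) (n : ℕ) : ℕ∞ :=
  ⨆ z : Tree Z n, seqCoverNumberOn L H α z

/-- The space of the tuples `(x, c, d, q)`: a sample, whether it is near degeneracy, the coin. -/
abbrev Obs {k d : ℕ} (X : Set (Fin k → ℝ)) (C : Set (Fin d → ℝ)) : Type := X × C × Bool × Bool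

/-- The re-weighted loss. -/
def rewLoss {k d : ℕ} {X : Set (Fin k → ℝ)} {C : Set (Fin d → ℝ)} (p : ℝ)
    (l : (Fin d → ℝ) → (Fin d → ℝ) → ℝ) (h : Predictor X d) (z : Obs X C) : ℝ :=
  match z with
  | (x, c, true, _) => l (h x) c
  | (x, c, false, true) => (1 / p) * l (h x) c
  | (_, _, false, false) => 0

/-- `N₁(ω_ℓ / n, ℓʳᵉʷ ∘ H, n)`. -/
def coverNum {k d : ℕ} {X : Set (Fin k → ℝ)} (C : Set (Fin d → ℝ)) (p : ℝ)
    (l : (Fin d → ℝ) → (Fin d → ℝ) → ℝ) (H : Set (Predictor X d)) (n : ℕ) : ℕ∞ :=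
  seqCoverNumber (Z := Obs X C) (rewLoss p l) H (lossSup l (predictionSpace H) C / n) n

/-- The radius `2 ω_ℓ [ p⁻¹ √(4 ln(2 n N₁(ω_ℓ / n, ℓʳᵉʷ ∘ H, n) / δ) / n) + 2 / n ]`, for
`n = t + n₀` (it is used when the covering number is finite). -/
def radius {k d : ℕ} {X : Set (Fin k → ℝ)} (C : Set (Fin d → ℝ)) (p δ : ℝ)
    (l : (Fin d → ℝ) → (Fin d → ℝ) → ℝ) (H : Set (Predictor X d)) (n₀ t : ℕ) : ℝ :=
  let n := t + n₀
  2 * lossSup l (predictionSpace H) C *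
    ((1 / p) * √(4 * Real.log (2 * n * (coverNum C p l H n).toNat / δ) / n) + 2 / n)

/-- The smaller radius `2 ω_ℓ [ p⁻¹ √(2 ln(2 N₁(ω_ℓ / n, ℓʳᵉʷ ∘ H, n) / δ) / n) + 2 / n ]`, for
`n = t + n₀`, which carries no allowance for a union over all iterations. -/
def fixedRadius {k d : ℕ} {X : Set (Fin k → ℝ)} (C : Set (Fin d → ℝ)) (p δ : ℝ)
    (l : (Fin d → ℝ) → (Fin d → ℝ) → ℝ) (H : Set (Predictor X d)) (n₀ t : ℕ) : ℝ :=
  let n := t + n₀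
  2 * lossSup l (predictionSpace H) C *
    ((1 / p) * √(2 * Real.log (2 * (coverNum C p l H n).toNat / δ) / n) + 2 / n)

/-! ### The margin-based active learning algorithm

The i.i.d. samples are `ξ 0, ξ 1, …`; the first `n₀` of them form the warm-up period, and iteration
`s + 1` observes `ξ (n₀ + s)`, with the predictor `h s`, the threshold `b s` and the coin `q s`. -/

/-- The rejection thresholds `b_t = b₀ (n₀ ln(n₀ + t) / t)^{1/4}` for `t ≥ 1`. -/
def threshold (n₀ : ℕ) (b₀ : ℝ) (t : ℕ) : ℝ :=
  if t = 0 then b₀ else b₀ * (n₀ * Real.log (n₀ + t) / t) ^ (1 / 4 : ℝ)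

/-- At iteration `s + 1` the sample is near degeneracy: `ν_S(h_s(x_{s+1})) < b_s`. -/
def IsNear {k d : ℕ} {X : Set (Fin k → ℝ)} {C : Set (Fin d → ℝ)} {Ω : Type*}
    (N : Seminorm ℝ (Fin d → ℝ)) (S : Set (Fin d → ℝ)) (n₀ : ℕ) (b : ℕ → ℝ)
    (ξ : ℕ → Ω → X × C) (h : ℕ → Ω → Predictor X d) (s : ℕ) (ω : Ω) : Prop :=
  distDegeneracy N S (h s ω (ξ (n₀ + s) ω).1) < ENNReal.ofReal (b s)

open Classical in
/-- The tuple `z = (x, c, d, q)` of iteration `s + 1`. -/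
def obs {k d : ℕ} {X : Set (Fin k → ℝ)} {C : Set (Fin d → ℝ)} {Ω : Type*}
    (N : Seminorm ℝ (Fin d → ℝ)) (S : Set (Fin d → ℝ)) (n₀ : ℕ) (b : ℕ → ℝ)
    (ξ : ℕ → Ω → X × C) (q : ℕ → Ω → Bool) (h : ℕ → Ω → Predictor X d) (s : ℕ) (ω : Ω) :
    Obs X C :=
  ((ξ (n₀ + s) ω).1, (ξ (n₀ + s) ω).2, decide (IsNear N S n₀ b ξ h s ω), q s ω)

/-- The empirical re-weighted risk of `g` after iteration `t`. -/
def empRisk {k d : ℕ} {X : Set (Fin k → ℝ)} {C : Set (Fin d → ℝ)} {Ω : Type*}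
    (N : Seminorm ℝ (Fin d → ℝ)) (S : Set (Fin d → ℝ)) (l : (Fin d → ℝ) → (Fin d → ℝ) → ℝ)
    (p : ℝ) (n₀ : ℕ) (b : ℕ → ℝ) (ξ : ℕ → Ω → X × C) (q : ℕ → Ω → Bool)
    (h : ℕ → Ω → Predictor X d) (t : ℕ) (g : Predictor X d) (ω : Ω) : ℝ :=
  (1 / ((t : ℝ) + n₀)) *
    (∑ i ∈ Finset.range n₀, l (g (ξ i ω).1) ((ξ i ω).2 : Fin d → ℝ) +
      ∑ s ∈ Finset.range t, rewLoss p l g (obs N S n₀ b ξ q h s ω))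

open Classical in
/-- The number of labels acquired during the iterations `1, …, T`. -/
def labelCount {k d : ℕ} {X : Set (Fin k → ℝ)} {C : Set (Fin d → ℝ)} {Ω : Type*}
    (N : Seminorm ℝ (Fin d → ℝ)) (S : Set (Fin d → ℝ)) (n₀ : ℕ) (b : ℕ → ℝ)
    (ξ : ℕ → Ω → X × C) (q : ℕ → Ω → Bool) (h : ℕ → Ω → Predictor X d) (T : ℕ) (ω : Ω) : ℕ :=
  ((Finset.range T).filter (fun s => IsNear N S n₀ b ξ h s ω ∨ q s ω = true)).card

/-- `(ξ, q, h)` is a run of the algorithm with thresholds `b`, soft-rejection probability `p` and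
warm-up length `n₀`, where the sigma-algebra `ℱ t` is the information at the end of iteration `t`
(for `t = 0`: at the end of the warm-up period). Ties in the minimization may be broken by any
rule, possibly randomized, that does not look into the future. -/
structure IsRun {k d : ℕ} {X : Set (Fin k → ℝ)} {C : Set (Fin d → ℝ)} {Ω : Type*}
    [mΩ : MeasurableSpace Ω] (μ : Measure Ω) (ℱ : Filtration ℕ mΩ) (D : Measure (X × C))
    (N : Seminorm ℝ (Fin d → ℝ)) (S : Set (Fin d → ℝ)) (H : Set (Predictor X d))
    (l : (Fin d → ℝ) → (Fin d → ℝ) → ℝ) (p : ℝ) (n₀ : ℕ) (b : ℕ → ℝ)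
    (ξ : ℕ → Ω → X × C) (q : ℕ → Ω → Bool) (h : ℕ → Ω → Predictor X d) : Prop where
  /-- the samples all have the distribution `D` -/
  law : ∀ i, μ.map (ξ i) = D
  /-- the coins show heads with probability `p` -/
  coin : ∀ s, μ {ω | q s ω = true} = ENNReal.ofReal p
  /-- the warm-up samples are independent and known at time `0` -/
  warm_indep : iIndepFun (fun (i : Fin n₀) => ξ i) μ
  warm_meas : ∀ i < n₀, Measurable[ℱ 0] (ξ i)
  /-- the sample and the coin of iteration `s + 1` are known at time `s + 1`, -/
  sample_meas : ∀ s, Measurable[ℱ (s + 1)] (ξ (n₀ + s))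
  coin_meas : ∀ s, Measurable[ℱ (s + 1)] (q s)
  /-- are independent of each other, -/
  sample_coin_indep : ∀ s, IndepFun (ξ (n₀ + s)) (q s) μ
  /-- and as a pair are independent of everything up to time `s` -/
  fresh : ∀ s, Indep
    (MeasurableSpace.comap (fun ω => (ξ (n₀ + s) ω, q s ω)) inferInstance) (ℱ s) μ
  /-- the predictor `h t` is a random element of `H` that is determined at time `t`, -/
  pred_mem : ∀ t ω, h t ω ∈ H
  pred_meas : ∀ t, @Measurable (Ω × X) (Fin d → ℝ) ((ℱ t).prod inferInstance) inferInstance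
    (fun y => h t y.1 y.2)
  /-- and minimizes the empirical re-weighted risk -/
  pred_min : ∀ᵐ ω ∂μ, ∀ t, ∀ g ∈ H,
    empRisk N S l p n₀ b ξ q h t (h t ω) ω ≤ empRisk N S l p n₀ b ξ q h t g ω

end

end MBAL

namespace MBAL

noncomputable section

/-! The re-weighted loss is unbiased given the past: a sample near degeneracy has weight 1, and any
other has weight `1 / p` with probability `p`, the coin being independent of the sample. So, however
past predictors steer the observations, each contributes the same conditional mean `risk D l g`, and
the task is a uniform law of large numbers for a dependent sequence.

That law is an exponential moment bound. Observations are replaced, last to first, by random signs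
times differences at two adversarially chosen points (`lintegral_iSup_exp_le`). The resulting game
splits into two Rademacher processes on trees (`pairSup_le_treeSup`), a finite cover replaces the
class on each tree, and each tree of the cover gives a sub-Gaussian sum (`signAvg_iSup_exp_le`).
Markov's inequality yields `IsRun.measure_deviation`, and comparing an empirical minimizer with a
true one yields (a). The thresholds play no role up to this point. The larger radius makes the
failure probabilities summable over iterations; the smaller one serves a single iteration.

For (b) and (c), the error bound turns a small surrogate excess into almost everywhere closeness to
some minimizer `g'` of the surrogate risk, which by consistency minimizes the SPO risk too
(`exists_minimizer_near`). Over a polyhedron the oracle is constant on segments of nondegenerate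
cost vectors (`oracle_eq_of_segment`), so both predictors lead to the same decision unless `g'` is
close to degeneracy; this gives (b) by `risk_spoLoss_sub_le`. If instead the current prediction is
within `b` of degeneracy, the triangle inequality puts `g'` within `2 * b` of it, which bounds the
label probability in (c) (`IsRun.measure_isNear_le`).

The suprema run over an uncountable class and over adversarial points, so their measurability is an
issue. A compact class is a standard Borel space, the superlevel sets of such suprema are analytic,
and analytic sets are measurable for the completion of any finite Borel measure. -/

/-! ### Suprema of measurable families are universally measurable -/

/-- A continuous image of the Baire space is approximated from inside by images of compact boxes. -/
theorem exists_box_lt_measure {Y : Type*} [TopologicalSpace Y] [MeasurableSpace Y]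
    (μ : Measure Y) (f : (ℕ → ℕ) → Y) {c : ℝ≥0∞} (hc : c < μ (Set.range f)) :
    ∃ m : ℕ → ℕ, ∀ k, c < μ (f '' {σ | ∀ i < k, σ i ≤ m i}) := by
  have step : ∀ (k : ℕ) (A : Set (ℕ → ℕ)), c < μ (f '' A) →
      ∃ m : ℕ, c < μ (f '' (A ∩ {σ | σ k ≤ m})) := by
    intro k A hA
    have hU : f '' A = ⋃ m : ℕ, f '' (A ∩ {σ | σ k ≤ m}) := by
      rw [← Set.image_iUnion, ← Set.inter_iUnion]
      congr 1
      refine (Set.inter_eq_left.2 fun σ _ => Set.mem_iUnion.2 ⟨σ k, le_refl (σ k)⟩).symm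
    have hmono : Monotone fun m : ℕ => f '' (A ∩ {σ | σ k ≤ m}) := fun a b hab =>
      Set.image_mono (Set.inter_subset_inter_right _ fun σ (h : σ k ≤ a) => h.trans hab)
    -- Continuity from below along increasing sets holds for outer measure, so the images need not
    -- be measurable.
    rw [hU, hmono.measure_iUnion] at hA
    exact lt_iSup_iff.1 hA
  choose! g hg using step
  let A : ℕ → Set (ℕ → ℕ) := fun n => Nat.rec Set.univ (fun k B => B ∩ {σ | σ k ≤ g k B}) n
  have hA : ∀ k, c < μ (f '' A k) := by
    intro k
    induction k with
    | zero => simpa [A] using hc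
    | succ k ih => exact hg k (A k) ih
  refine ⟨fun k => g k (A k), fun k => (hA k).trans_le (measure_mono (Set.image_mono ?_))⟩
  intro σ hσ
  induction k with
  | zero => simp
  | succ k ih =>
    have h2 : σ ∈ A k ∩ {σ | σ k ≤ g k (A k)} := hσ
    intro i hi
    rcases Nat.lt_succ_iff_lt_or_eq.1 hi with h | rfl
    · exact ih h2.1 i h
    · exact h2.2

/-- Bounding all coordinates at once gives a compact box, but only the images of the boxes with
finitely many bounded coordinates are known to have measure above `c`. Outer regularity bridges the
gap: by compactness, every open set around the image of the full box already contains the image of a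
finite-stage box. -/
theorem exists_isCompact_subset_analyticSet {Y : Type*} [TopologicalSpace Y] [PolishSpace Y]
    [MeasurableSpace Y] [BorelSpace Y] (μ : Measure Y) [IsFiniteMeasure μ] {s : Set Y}
    (hs : AnalyticSet s) {c : ℝ≥0∞} (hc : c < μ s) : ∃ K ⊆ s, IsCompact K ∧ c ≤ μ K := by
  rw [AnalyticSet] at hs
  rcases hs with rfl | ⟨f, hf, rfl⟩
  · simp at hc
  obtain ⟨m, hm⟩ := exists_box_lt_measure μ f hc
  let T : Set (ℕ → ℕ) := Set.univ.pi fun i => Set.Iic (m i)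
  have hT : IsCompact T := isCompact_univ_pi fun i => (Set.finite_Iic (m i)).isCompact
  refine ⟨f '' T, Set.image_subset_range _ _, hT.image hf, ?_⟩
  let := TopologicalSpace.upgradeIsCompletelyMetrizable Y
  rw [Set.measure_eq_iInf_isOpen]
  refine le_iInf₂ fun U hTU => le_iInf fun hU => ?_
  suffices h : ∃ k, {σ : ℕ → ℕ | ∀ i < k, σ i ≤ m i} ⊆ f ⁻¹' U by
    obtain ⟨k, hk⟩ := h
    exact (hm k).le.trans (measure_mono (Set.image_subset_iff.2 hk))
  by_contra! hcon
  simp only [Set.not_subset] at hcon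
  choose τ hτ hτU using hcon
  -- Clamping moves the counterexamples into the compact box without changing the coordinates below
  -- `k`, so a limit of the clamped points is also a limit of the original ones.
  have hmem : ∀ k, (fun i => min (τ k i) (m i)) ∈ T := fun k i _ => Set.mem_Iic.2 (min_le_right _ _)
  obtain ⟨ρ, hρ, θ, hθ, hlim⟩ := hT.tendsto_subseq hmem
  have hlim2 : Tendsto (fun k => τ (θ k)) atTop (𝓝 ρ) := by
    rw [tendsto_pi_nhds] at hlim ⊢
    intro i
    refine (hlim i).congr' ?_
    filter_upwards [eventually_gt_atTop i] with k hk
    exact min_eq_left (hτ _ i (hk.trans_le (hθ.id_le k)))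
  have hρU : ρ ∈ f ⁻¹' U := hTU (Set.mem_image_of_mem f hρ)
  obtain ⟨k, hk⟩ := (hlim2.eventually ((hU.preimage hf).mem_nhds hρU)).exists
  exact hτU _ hk

/-- Analytic sets are measurable for the completion of every finite Borel measure. -/
theorem nullMeasurableSet_of_analyticSet {Y : Type*} [TopologicalSpace Y] [PolishSpace Y]
    [MeasurableSpace Y] [BorelSpace Y] (μ : Measure Y) [IsFiniteMeasure μ] {s : Set Y}
    (hs : AnalyticSet s) : NullMeasurableSet s μ := by
  have key : ∃ t ⊆ s, MeasurableSet t ∧ μ s ≤ μ t := by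
    rcases eq_or_ne (μ s) 0 with h0 | h0
    · exact ⟨∅, Set.empty_subset _, MeasurableSet.empty, by simp [h0]⟩
    obtain ⟨u, -, hu, hlim⟩ := exists_seq_strictMono_tendsto' (pos_iff_ne_zero.2 h0)
    have : ∀ n, ∃ K ⊆ s, IsCompact K ∧ u n ≤ μ K := fun n =>
      exists_isCompact_subset_analyticSet μ hs (hu n).2
    choose K hKs hK hle using this
    refine ⟨⋃ n, K n, Set.iUnion_subset hKs, .iUnion fun n => (hK n).measurableSet, ?_⟩
    exact le_of_tendsto' hlim fun n => (hle n).trans (measure_mono (Set.subset_iUnion K n))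
  obtain ⟨t, hts, ht, hle⟩ := key
  refine ⟨t, ht, ?_⟩
  have h1 : μ (toMeasurable μ s \ t) = 0 := by
    rw [measure_sdiff (hts.trans (subset_toMeasurable μ s)) ht.nullMeasurableSet
      (measure_ne_top _ _), measure_toMeasurable]
    exact tsub_eq_zero_of_le hle
  refine (ae_eq_set.2 ⟨measure_mono_null ?_ h1, ?_⟩)
  · exact Set.sdiff_subset_sdiff_left (subset_toMeasurable μ s)
  · rw [Set.sdiff_eq_empty.2 hts, measure_empty]

/-- A function that is the supremum of a jointly measurable family with parameter in a standard
Borel space. -/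
def IsMeasurableSup {Y : Type*} [MeasurableSpace Y] (u : Y → ℝ≥0∞) : Prop :=
  ∃ (P : Type) (_ : MeasurableSpace P) (_ : StandardBorelSpace P) (_ : Nonempty P) (g : Y × P → ℝ≥0∞),
    Measurable g ∧ ∀ y, u y = ⨆ p, g (y, p)

namespace IsMeasurableSup

variable {Y Z : Type*} [MeasurableSpace Y] [MeasurableSpace Z]

theorem comp {u : Y → ℝ≥0∞} (hu : IsMeasurableSup u) {T : Z → Y} (hT : Measurable T) :
    IsMeasurableSup fun z => u (T z) := by
  obtain ⟨P, mP, sP, nP, g, hg, h⟩ := hu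
  exact ⟨P, mP, sP, nP, fun y => g (T y.1, y.2), by fun_prop, fun z => h (T z)⟩

/-- The class is closed under suprema over a further standard Borel parameter, which measurability
in the ordinary sense is not; the recursion of `pairSup` nests such suprema. -/
theorem iSup {Q : Type} [MeasurableSpace Q] [StandardBorelSpace Q] [Nonempty Q] {u : Y × Q → ℝ≥0∞}
    (hu : IsMeasurableSup u) : IsMeasurableSup fun y => ⨆ q, u (y, q) := by
  obtain ⟨P, mP, sP, nP, g, hg, h⟩ := hu
  refine ⟨Q × P, inferInstance, inferInstance, inferInstance, fun y => g ((y.1, y.2.1), y.2.2), by fun_prop,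
    fun y => ?_⟩
  simp only [h, iSup_prod]

theorem of_measurable {u : Y → ℝ≥0∞} (hu : Measurable u) : IsMeasurableSup u :=
  ⟨Unit, inferInstance, inferInstance, inferInstance, fun y => u y.1, by fun_prop, fun y => by simp⟩

theorem add {u v : Y → ℝ≥0∞} (hu : IsMeasurableSup u) (hv : IsMeasurableSup v) :
    IsMeasurableSup fun y => u y + v y := by
  obtain ⟨P, mP, sP, nP, g, hg, h⟩ := hu
  obtain ⟨P', mP', sP', nP', g', hg', h'⟩ := hv
  refine ⟨P × P', inferInstance, inferInstance, inferInstance, fun y => g (y.1, y.2.1) + g' (y.1, y.2.2),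
    by fun_prop, fun y => ?_⟩
  simp only [h, h', iSup_prod]
  rw [ENNReal.iSup_add]
  simp only [ENNReal.add_iSup]

theorem const_mul {u : Y → ℝ≥0∞} (hu : IsMeasurableSup u) (c : ℝ≥0∞) :
    IsMeasurableSup fun y => c * u y := by
  obtain ⟨P, mP, sP, nP, g, hg, h⟩ := hu
  exact ⟨P, mP, sP, nP, fun y => c * g y, by fun_prop, fun y => by simp [h, ENNReal.mul_iSup]⟩

/-- The measurable projection theorem, in terms of functions. -/
theorem aemeasurable [StandardBorelSpace Y] {u : Y → ℝ≥0∞} (hu : IsMeasurableSup u)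
    (μ : Measure Y) [IsFiniteMeasure μ] : AEMeasurable u μ := by
  obtain ⟨P, mP, sP, nP, g, hg, h⟩ := hu
  let := upgradeStandardBorel Y
  suffices hn : NullMeasurable u μ from hn.aemeasurable
  have hs : ∀ a, NullMeasurableSet (u ⁻¹' Set.Ioi a) μ := by
    intro a
    -- A supremum exceeds `a` exactly when some parameter does, so the superlevel set is a
    -- projection of a Borel set, hence analytic.
    have : u ⁻¹' Set.Ioi a = Prod.fst '' (g ⁻¹' Set.Ioi a) := by
      ext y
      simp [h, lt_iSup_iff]
    rw [this]
    exact nullMeasurableSet_of_analyticSet μ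
      ((hg measurableSet_Ioi).analyticSet_image measurable_fst)
  have : Measurable[(inferInstance : MeasurableSpace (NullMeasurableSpace Y μ))] u :=
    measurable_of_Ioi hs
  exact fun s hs => this hs

end IsMeasurableSup

/-! ### Sequential symmetrization -/

section Symmetrization

variable {K Z : Type}

/-- The worst case, over pairs of adversarially chosen trees of depth `n`, of the expectation over
random signs of `sup_h exp (F h + c ∑ᵢ σᵢ (f h zᵢ - f h zᵢ'))`. -/
def pairSup (f : K → Z → ℝ) (c : ℝ) : ℕ → (K → ℝ) → ℝ≥0∞
  | 0, F => ⨆ h, ENNReal.ofReal (Real.exp (F h))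
  | n + 1, F => ⨆ z : Z × Z, 2⁻¹ * (pairSup f c n (fun h => F h + c * (f h z.1 - f h z.2)) +
      pairSup f c n (fun h => F h - c * (f h z.1 - f h z.2)))

variable {f : K → Z → ℝ}

/-- Jensen's inequality for the convex functional `pairSup f c n`. At depth 0 it is Jensen for the
exponential; the recursion preserves it, since a supremum of integrals is at most the integral of
the supremum and the lower integral is superadditive. Neither fact needs measurability of `pairSup`.
-/
theorem pairSup_integral_le {W : Type*} [MeasurableSpace W] (Q : Measure W)
    [IsProbabilityMeasure Q] (c : ℝ) (n : ℕ) {F : W → K → ℝ}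
    (hF : ∀ h, Measurable fun w => F w h) (hb : ∀ h, ∃ B, ∀ w, |F w h| ≤ B) :
    pairSup f c n (fun h => ∫ w, F w h ∂Q) ≤ ∫⁻ w, pairSup f c n (F w) ∂Q := by
  induction n generalizing F with
  | zero =>
    refine iSup_le fun h => ?_
    obtain ⟨B, hB⟩ := hb h
    have h1 : Integrable (fun w => F w h) Q :=
      .of_bound (hF h).aestronglyMeasurable B (ae_of_all _ hB)
    have h2 : Integrable (fun w => Real.exp (F w h)) Q := by
      refine .of_bound (hF h).exp.aestronglyMeasurable (Real.exp B) (ae_of_all _ fun w => ?_)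
      rw [Real.norm_eq_abs, Real.abs_exp, Real.exp_le_exp]
      exact (abs_le.1 (hB w)).2
    calc ENNReal.ofReal (Real.exp (∫ w, F w h ∂Q))
        ≤ ENNReal.ofReal (∫ w, Real.exp (F w h) ∂Q) := by
          refine ENNReal.ofReal_le_ofReal ?_
          exact convexOn_exp.map_integral_le Real.continuous_exp.continuousOn isClosed_univ
            (by simp) h1 h2
      _ = ∫⁻ w, ENNReal.ofReal (Real.exp (F w h)) ∂Q :=
          ofReal_integral_eq_lintegral_ofReal h2 (ae_of_all _ fun w => (Real.exp_pos _).le)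
      _ ≤ ∫⁻ w, pairSup f c 0 (F w) ∂Q := lintegral_mono fun w =>
          le_iSup (fun h => ENNReal.ofReal (Real.exp (F w h))) h
  | succ n ih =>
    refine iSup_le fun z => ?_
    have hint : ∀ h, Integrable (fun w => F w h) Q := fun h => by
      obtain ⟨B, hB⟩ := hb h
      exact .of_bound (hF h).aestronglyMeasurable B (ae_of_all _ hB)
    have key : ∀ a : K → ℝ, pairSup f c n (fun h => ∫ w, F w h ∂Q + a h) ≤
        ∫⁻ w, pairSup f c n (fun h => F w h + a h) ∂Q := by
      intro a
      have : (fun h => ∫ w, F w h ∂Q + a h) = fun h => ∫ w, (F w h + a h) ∂Q := by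
        ext h
        rw [integral_add (hint h) (integrable_const _)]
        simp
      rw [this]
      refine ih (fun h => (hF h).add_const _) fun h => ?_
      obtain ⟨B, hB⟩ := hb h
      exact ⟨B + |a h|, fun w => (abs_add_le _ _).trans (by linarith [hB w])⟩
    calc _ ≤ 2⁻¹ * (∫⁻ w, pairSup f c n (fun h => F w h + c * (f h z.1 - f h z.2)) ∂Q +
          ∫⁻ w, pairSup f c n (fun h => F w h - c * (f h z.1 - f h z.2)) ∂Q) := by
          gcongr
          · exact key _
          · simpa only [sub_eq_add_neg] using key fun h => -(c * (f h z.1 - f h z.2))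
      _ ≤ 2⁻¹ * ∫⁻ w, (pairSup f c n (fun h => F w h + c * (f h z.1 - f h z.2)) +
          pairSup f c n (fun h => F w h - c * (f h z.1 - f h z.2))) ∂Q := by
          gcongr
          exact le_lintegral_add _ _
      _ = ∫⁻ w, 2⁻¹ * (pairSup f c n (fun h => F w h + c * (f h z.1 - f h z.2)) +
          pairSup f c n (fun h => F w h - c * (f h z.1 - f h z.2))) ∂Q :=
          (lintegral_const_mul' _ _ (by simp)).symm
      _ ≤ _ := lintegral_mono fun w => le_iSup (fun z : Z × Z =>
          2⁻¹ * (pairSup f c n (fun h => F w h + c * (f h z.1 - f h z.2)) +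
          pairSup f c n (fun h => F w h - c * (f h z.1 - f h z.2)))) z

variable [MeasurableSpace K] [StandardBorelSpace K] [Nonempty K]
  [MeasurableSpace Z] [StandardBorelSpace Z] [Nonempty Z]

theorem isMeasurableSup_pairSup (hf : Measurable (Function.uncurry f)) (c : ℝ) (n : ℕ)
    {Y : Type*} [MeasurableSpace Y] {F : Y → K → ℝ} (hF : Measurable (Function.uncurry F)) :
    IsMeasurableSup fun y => pairSup f c n (F y) := by
  induction n generalizing Y with
  | zero =>
    refine IsMeasurableSup.iSup (u := fun y : Y × K => ENNReal.ofReal (Real.exp (F y.1 y.2)))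
      (.of_measurable ?_)
    exact (Real.measurable_exp.comp hF).ennreal_ofReal
  | succ n ih =>
    have h1 : Measurable fun y : (Y × Z × Z) × K => F y.1.1 y.2 :=
      hF.comp (f := fun y : (Y × Z × Z) × K => (y.1.1, y.2)) (by fun_prop)
    have h2 : Measurable fun y : (Y × Z × Z) × K => f y.2 y.1.2.1 :=
      hf.comp (f := fun y : (Y × Z × Z) × K => (y.2, y.1.2.1)) (by fun_prop)
    have h3 : Measurable fun y : (Y × Z × Z) × K => f y.2 y.1.2.2 :=
      hf.comp (f := fun y : (Y × Z × Z) × K => (y.2, y.1.2.2)) (by fun_prop)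
    refine IsMeasurableSup.iSup (u := fun y : Y × Z × Z =>
      2⁻¹ * (pairSup f c n (fun h => F y.1 h + c * (f h y.2.1 - f h y.2.2)) +
      pairSup f c n (fun h => F y.1 h - c * (f h y.2.1 - f h y.2.2)))) ?_
    refine .const_mul (.add (ih ?_) (ih ?_)) _
    · exact h1.add ((h2.sub h3).const_mul c)
    · exact h1.sub ((h2.sub h3).const_mul c)

/-- One step of the symmetrization: centering by the mean is dominated by a random sign in front
of the difference of two adversarially chosen points. -/
theorem lintegral_pairSup_le (hf : Measurable (Function.uncurry f)) {M : ℝ}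
    (hM : ∀ h z, |f h z| ≤ M) (Q : Measure Z) [IsProbabilityMeasure Q] (c : ℝ) (n : ℕ)
    {F : K → ℝ} (hF : Measurable F) :
    ∫⁻ z, pairSup f c n (fun h => F h + c * (f h z - ∫ z', f h z' ∂Q)) ∂Q ≤
      pairSup f c (n + 1) F := by
  have hfh : ∀ h, Measurable (f h) := fun h => hf.comp measurable_prodMk_left
  have hint : ∀ h, Integrable (f h) Q := fun h =>
    .of_bound (hfh h).aestronglyMeasurable M (ae_of_all _ (hM h))
  let g : Z × Z → ℝ≥0∞ := fun z => pairSup f c n (fun h => F h + c * (f h z.1 - f h z.2))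
  have hg : AEMeasurable g (Q.prod Q) := by
    refine (isMeasurableSup_pairSup (Y := Z × Z) hf c n ?_).aemeasurable _
    have h2 : Measurable fun y : (Z × Z) × K => f y.2 y.1.1 :=
      hf.comp (f := fun y : (Z × Z) × K => (y.2, y.1.1)) (by fun_prop)
    have h3 : Measurable fun y : (Z × Z) × K => f y.2 y.1.2 :=
      hf.comp (f := fun y : (Z × Z) × K => (y.2, y.1.2)) (by fun_prop)
    exact (hF.comp measurable_snd).add ((h2.sub h3).const_mul c)
  -- Exchanging the observation with its independent copy flips the sign of the difference.
  -- Averaging both orders creates the random sign, and the supremum over pairs then removes the law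
  -- `Q`.
  have hswap : ∫⁻ z, g z.swap ∂(Q.prod Q) = ∫⁻ z, g z ∂(Q.prod Q) :=
    lintegral_prod_swap g
  calc ∫⁻ z, pairSup f c n (fun h => F h + c * (f h z - ∫ z', f h z' ∂Q)) ∂Q
      ≤ ∫⁻ z, ∫⁻ z', g (z, z') ∂Q ∂Q := by
        refine lintegral_mono fun z => ?_
        have : (fun h => F h + c * (f h z - ∫ z', f h z' ∂Q)) =
            fun h => ∫ z', (F h + c * (f h z - f h z')) ∂Q := by
          ext h
          have h1 : Integrable (fun z' => f h z - f h z') Q := (integrable_const _).sub (hint h)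
          rw [integral_add (integrable_const _) (h1.const_mul c),
            integral_const_mul, integral_sub (integrable_const _) (hint h)]
          simp
        rw [this]
        refine pairSup_integral_le Q c n (fun h => ?_) fun h => ?_
        · exact ((((hfh h).const_sub _)).const_mul c).const_add _
        · refine ⟨|F h| + |c| * (M + M), fun w => (abs_add_le _ _).trans ?_⟩
          rw [abs_mul]
          gcongr
          exact (abs_sub _ _).trans (add_le_add (hM _ _) (hM _ _))
    _ = ∫⁻ z, g z ∂(Q.prod Q) := (lintegral_prod g hg).symm
    _ = 2⁻¹ * (∫⁻ z, g z ∂(Q.prod Q) + ∫⁻ z, g z.swap ∂(Q.prod Q)) := by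
        rw [hswap, ← two_mul, ← mul_assoc, ENNReal.inv_mul_cancel (by simp) (by simp), one_mul]
    _ ≤ 2⁻¹ * ∫⁻ z, (g z + g z.swap) ∂(Q.prod Q) := by
        gcongr
        exact le_lintegral_add _ _
    _ = ∫⁻ z, 2⁻¹ * (g z + g z.swap) ∂(Q.prod Q) := (lintegral_const_mul' _ _ (by simp)).symm
    _ ≤ ∫⁻ _, pairSup f c (n + 1) F ∂(Q.prod Q) := by
        refine lintegral_mono fun z => ?_
        have : g z.swap = pairSup f c n (fun h => F h - c * (f h z.1 - f h z.2)) := by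
          simp only [g, Prod.fst_swap, Prod.snd_swap]
          congr 1
          ext h
          ring
        rw [this]
        exact le_iSup (fun z : Z × Z =>
          2⁻¹ * (pairSup f c n (fun h => F h + c * (f h z.1 - f h z.2)) +
          pairSup f c n (fun h => F h - c * (f h z.1 - f h z.2)))) z
    _ = pairSup f c (n + 1) F := by simp

variable {Ω : Type*} [MeasurableSpace Ω]

/-- One step of the symmetrization along a process, where `κ ω` is the conditional law of the next
observation given the history. -/
theorem lintegral_pairSup_comp_le {Y : Type*} [MeasurableSpace Y] [StandardBorelSpace Y]
    (hf : Measurable (Function.uncurry f)) {M : ℝ} (hM : ∀ h z, |f h z| ≤ M)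
    (μ : Measure Ω) [IsProbabilityMeasure μ] {past : Ω → Y} (hpast : Measurable past)
    {ζ : Ω → Z} (hζ : Measurable ζ) (κ : Ω → Measure Z) [∀ ω, IsProbabilityMeasure (κ ω)]
    (hκ : ∀ g : Y × Z → ℝ≥0∞, Measurable g →
      ∫⁻ ω, g (past ω, ζ ω) ∂μ = ∫⁻ ω, ∫⁻ z, g (past ω, z) ∂(κ ω) ∂μ)
    {R : K → ℝ} (hR : ∀ ω h, ∫ z, f h z ∂(κ ω) = R h) (c : ℝ) (n : ℕ)
    {F : Y → K → ℝ} (hF : Measurable (Function.uncurry F)) :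
    ∫⁻ ω, pairSup f c n (fun h => F (past ω) h + c * (f h (ζ ω) - R h)) ∂μ ≤
      ∫⁻ ω, pairSup f c (n + 1) (F (past ω)) ∂μ := by
  obtain ⟨ω₀⟩ : Nonempty Ω := nonempty_of_isProbabilityMeasure μ
  have hRm : Measurable R := by
    have : R = fun h => ∫ z, f h z ∂(κ ω₀) := funext fun h => (hR ω₀ h).symm
    rw [this]
    exact (hf.stronglyMeasurable.integral_prod_right (ν := κ ω₀)).measurable
  let G : Y × Z → ℝ≥0∞ := fun y => pairSup f c n (fun h => F y.1 h + c * (f h y.2 - R h))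
  have hG : AEMeasurable G (μ.map fun ω => (past ω, ζ ω)) := by
    refine (isMeasurableSup_pairSup (Y := Y × Z) hf c n ?_).aemeasurable _
    have h2 : Measurable fun y : (Y × Z) × K => f y.2 y.1.2 :=
      hf.comp (f := fun y : (Y × Z) × K => (y.2, y.1.2)) (by fun_prop)
    have h3 : Measurable fun y : (Y × Z) × K => F y.1.1 y.2 :=
      hF.comp (f := fun y : (Y × Z) × K => (y.1.1, y.2)) (by fun_prop)
    exact h3.add ((h2.sub (hRm.comp measurable_snd)).const_mul c)
  have hpair : Measurable fun ω => (past ω, ζ ω) := hpast.prodMk hζ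
  -- The disintegration `hκ` is available for measurable functions only, so `G` is replaced by a
  -- measurable minorant with the same integral. The bound `g ≤ G` is used again after conditioning.
  obtain ⟨g, hg, hgG, hgint⟩ := exists_measurable_le_lintegral_eq (μ.map fun ω => (past ω, ζ ω)) G
  calc ∫⁻ ω, G (past ω, ζ ω) ∂μ = ∫⁻ y, G y ∂(μ.map fun ω => (past ω, ζ ω)) :=
        (lintegral_map' hG hpair.aemeasurable).symm
    _ = ∫⁻ ω, g (past ω, ζ ω) ∂μ := by rw [hgint, lintegral_map hg hpair]
    _ = ∫⁻ ω, ∫⁻ z, g (past ω, z) ∂(κ ω) ∂μ := hκ g hg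
    _ ≤ ∫⁻ ω, ∫⁻ z, G (past ω, z) ∂(κ ω) ∂μ :=
        lintegral_mono fun ω => lintegral_mono fun z => hgG _
    _ ≤ _ := by
        refine lintegral_mono fun ω => ?_
        have := lintegral_pairSup_le hf hM (κ ω) c n
          (hF.comp (measurable_prodMk_left (x := past ω)))
        simpa only [hR, G, Function.comp_def, Function.uncurry] using this

/-- The exponential moment of the supremum of a centered process is dominated by its symmetrized
worst case. -/
theorem lintegral_iSup_exp_le (hf : Measurable (Function.uncurry f)) {M : ℝ}
    (hM : ∀ h z, |f h z| ≤ M) (μ : Measure Ω) [IsProbabilityMeasure μ] {n : ℕ} {ζ : ℕ → Ω → Z}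
    (hζ : ∀ i < n, Measurable (ζ i)) (κ : ℕ → Ω → Measure Z)
    (hκp : ∀ i ω, IsProbabilityMeasure (κ i ω))
    (hκ : ∀ i < n, ∀ g : (Fin i → Z) × Z → ℝ≥0∞, Measurable g →
      ∫⁻ ω, g (fun j => ζ j ω, ζ i ω) ∂μ = ∫⁻ ω, ∫⁻ z, g (fun j => ζ j ω, z) ∂(κ i ω) ∂μ)
    {R : K → ℝ} (hR : ∀ i < n, ∀ ω h, ∫ z, f h z ∂(κ i ω) = R h) (c : ℝ) :
    ∫⁻ ω, ⨆ h, ENNReal.ofReal (Real.exp (c * ∑ i ∈ Finset.range n, (f h (ζ i ω) - R h))) ∂μ ≤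
      pairSup f c n 0 := by
  -- Interpolation: the first `i` observations are genuine and the remaining `n - i` are
  -- adversarial. At `i = n` this is the quantity to bound, at `i = 0` it is deterministic.
  suffices key : ∀ i ≤ n, ∫⁻ ω, pairSup f c (n - i)
      (fun h => c * ∑ j ∈ Finset.range i, (f h (ζ j ω) - R h)) ∂μ ≤ pairSup f c n 0 by
    have := key n le_rfl
    rw [Nat.sub_self] at this
    exact this
  intro i hi
  induction i with
  | zero =>
    simp only [Finset.range_zero, Finset.sum_empty, mul_zero, Nat.sub_zero, lintegral_const,
      measure_univ, mul_one]
    exact le_rfl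
  | succ i ih =>
    refine le_trans ?_ (ih (by omega))
    have hin : i < n := by omega
    have hn : n - i = n - (i + 1) + 1 := by omega
    obtain ⟨ω₀⟩ : Nonempty Ω := nonempty_of_isProbabilityMeasure μ
    have hRm : Measurable R := by
      have : R = fun h => ∫ z, f h z ∂(κ i ω₀) := funext fun h => (hR i hin ω₀ h).symm
      rw [this]
      exact (hf.stronglyMeasurable.integral_prod_right (ν := κ i ω₀)).measurable
    have := lintegral_pairSup_comp_le (Y := Fin i → Z) hf hM μ (past := fun ω j => ζ j ω)
      (measurable_pi_lambda _ fun j => hζ _ (j.2.trans hin)) (hζ i hin) (κ i) (hκ i hin)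
      (hR i hin) c (n - (i + 1)) (F := fun y h => c * ∑ j : Fin i, (f h (y j) - R h)) (by
        refine Measurable.const_mul (Finset.measurable_fun_sum _ fun j _ => ?_) c
        exact (hf.comp (f := fun y : (Fin i → Z) × K => (y.2, y.1 j)) (by fun_prop)).sub
          (hRm.comp measurable_snd))
    rw [hn]
    simp only [Finset.sum_range_succ, mul_add]
    simpa only [Finset.sum_range] using this

end Symmetrization

/-! ### Trees and the covering number bound -/

/-- The expectation over independent uniform random signs. -/
def signAvg (n : ℕ) (u : (Fin n → Bool) → ℝ≥0∞) : ℝ≥0∞ := (2 ^ n)⁻¹ * ∑ σ, u σ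

/-- The sign encoded by a Boolean. -/
def sgn (b : Bool) : ℝ := if b then 1 else -1

theorem abs_sgn (b : Bool) : |sgn b| = 1 := by cases b <;> simp [sgn]

theorem signAvg_zero (u : (Fin 0 → Bool) → ℝ≥0∞) : signAvg 0 u = u Fin.elim0 := by
  simp only [signAvg, pow_zero, inv_one, Finset.univ_unique, Finset.sum_singleton, one_mul]
  congr 1

theorem signAvg_succ (n : ℕ) (u : (Fin (n + 1) → Bool) → ℝ≥0∞) :
    signAvg (n + 1) u = 2⁻¹ * (signAvg n (fun σ => u (Fin.cons true σ)) +
      signAvg n (fun σ => u (Fin.cons false σ))) := by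
  have h : ∑ σ, u σ = ∑ σ : Fin n → Bool, u (Fin.cons true σ) +
      ∑ σ : Fin n → Bool, u (Fin.cons false σ) := by
    rw [← (Fin.consEquiv fun _ : Fin (n + 1) => Bool).sum_comp, Fintype.sum_prod_type,
      Fintype.sum_bool]
    rfl
  simp only [signAvg, h]
  rw [pow_succ', ENNReal.mul_inv (by simp) (by simp), ← mul_add, mul_assoc]

theorem signAvg_mono {n : ℕ} {u v : (Fin n → Bool) → ℝ≥0∞} (h : ∀ σ, u σ ≤ v σ) :
    signAvg n u ≤ signAvg n v := by
  unfold signAvg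
  gcongr
  exact h _

theorem signAvg_finset_sum {n : ℕ} {ι : Type*} (s : Finset ι) (u : ι → (Fin n → Bool) → ℝ≥0∞) :
    signAvg n (fun σ => ∑ i ∈ s, u i σ) = ∑ i ∈ s, signAvg n (u i) := by
  unfold signAvg
  rw [Finset.sum_comm, Finset.mul_sum]

theorem signAvg_const_mul {n : ℕ} (a : ℝ≥0∞) (u : (Fin n → Bool) → ℝ≥0∞) :
    signAvg n (fun σ => a * u σ) = a * signAvg n u := by
  unfold signAvg
  rw [← Finset.mul_sum]
  ring

namespace Tree

variable {A : Type} {n : ℕ}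

/-- The subtree below the child of the root in the direction `b`. -/
def sub (z : Tree A (n + 1)) (b : Bool) : Tree A n :=
  fun t p => z t.succ (Fin.cons b p : Fin (t + 1) → Bool)

/-- The tree with the root label `a` and the subtrees `S`. -/
def node (a : A) (S : Bool → Tree A n) : Tree A (n + 1) :=
  fun t => Fin.cases (motive := fun t : Fin (n + 1) => (Fin t → Bool) → A) (fun _ => a)
    (fun (t : Fin n) (p : Fin (t + 1) → Bool) => S (p 0) t (fun i => p i.succ)) t

theorem along_cons_succ (z : Tree A (n + 1)) (b : Bool) (σ : Fin n → Bool) (t : Fin n) :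
    z.along (Fin.cons b σ) t.succ = (z.sub b).along σ t := by
  unfold along sub
  congr 1
  funext i
  induction i using Fin.cases with
  | zero => rfl
  | succ i => rfl

theorem along_zero (z : Tree A (n + 1)) (σ : Fin (n + 1) → Bool) :
    z.along σ 0 = z 0 Fin.elim0 := by
  unfold along
  congr 1
  funext i
  exact i.elim0

theorem along_node_zero (a : A) (S : Bool → Tree A n) (σ : Fin (n + 1) → Bool) :
    (node a S).along σ 0 = a := rfl

theorem along_node_succ (a : A) (S : Bool → Tree A n) (b : Bool) (σ : Fin n → Bool) (t : Fin n) :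
    (node a S).along (Fin.cons b σ) t.succ = (S b).along σ t := rfl

instance [Nonempty A] : Nonempty (Tree A n) := ⟨fun _ _ => Classical.arbitrary A⟩

end Tree

section TreeBounds

variable {K Z : Type}

/-- The worst case, over an adversarially chosen tree of depth `n`, of the expectation over
random signs of `sup_h exp (F h + c ∑ᵢ σᵢ f h zᵢ)`. -/
def treeSup (f : K → Z → ℝ) (c : ℝ) : ℕ → (K → ℝ) → ℝ≥0∞
  | 0, F => ⨆ h, ENNReal.ofReal (Real.exp (F h))
  | n + 1, F => ⨆ z : Z, 2⁻¹ * (treeSup f c n (fun h => F h + c * f h z) +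
      treeSup f c n (fun h => F h - c * f h z))

/-- The inequality `exp (x + y) ≤ (exp (2x) + exp (2y)) / 2` separates the two points of every pair,
at the price of doubling `c`. The minus sign in front of the second point is harmless because each
level averages over both signs. A constant `a` cancels in the differences and is free; centering the
range with it later halves the increments and makes up for the doubling. -/
theorem pairSup_le_treeSup (f : K → Z → ℝ) (a c : ℝ) (n : ℕ) (F F' : K → ℝ) :
    pairSup f c n (fun h => F h + F' h) ≤
      2⁻¹ * (treeSup (fun h z => f h z - a) (2 * c) n (fun h => 2 * F h) +
        treeSup (fun h z => f h z - a) (2 * c) n (fun h => 2 * F' h)) := by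
  induction n generalizing F F' with
  | zero =>
    refine iSup_le fun h => ?_
    have h1 : Real.exp (F h + F' h) ≤ 2⁻¹ * (Real.exp (2 * F h) + Real.exp (2 * F' h)) := by
      have e1 : Real.exp (2 * F h) = Real.exp (F h) ^ 2 := by rw [← Real.exp_nat_mul]; norm_num
      have e2 : Real.exp (2 * F' h) = Real.exp (F' h) ^ 2 := by rw [← Real.exp_nat_mul]; norm_num
      rw [e1, e2, Real.exp_add]
      nlinarith [sq_nonneg (Real.exp (F h) - Real.exp (F' h))]
    refine (ENNReal.ofReal_le_ofReal h1).trans ?_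
    rw [ENNReal.ofReal_mul (by norm_num), ENNReal.ofReal_add (Real.exp_pos _).le (Real.exp_pos _).le,
      ENNReal.ofReal_inv_of_pos (by norm_num), ENNReal.ofReal_ofNat]
    gcongr
    · exact le_iSup (fun h => ENNReal.ofReal (Real.exp (2 * F h))) h
    · exact le_iSup (fun h => ENNReal.ofReal (Real.exp (2 * F' h))) h
  | succ n ih =>
    refine iSup_le fun z => ?_
    have h1 := ih (fun h => F h + c * (f h z.1 - a)) (fun h => F' h - c * (f h z.2 - a))
    have h2 := ih (fun h => F h - c * (f h z.1 - a)) (fun h => F' h + c * (f h z.2 - a))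
    have e1 : (fun h => F h + F' h + c * (f h z.1 - f h z.2)) =
      fun h => F h + c * (f h z.1 - a) + (F' h - c * (f h z.2 - a)) := by ext h; ring
    have e2 : (fun h => F h + F' h - c * (f h z.1 - f h z.2)) =
      fun h => F h - c * (f h z.1 - a) + (F' h + c * (f h z.2 - a)) := by ext h; ring
    simp only [mul_add, mul_sub, ← mul_assoc] at h1 h2 e1 e2
    simp only [mul_sub]
    rw [e1, e2]
    set T := treeSup (fun h z => f h z - a) (2 * c) n
    calc _ ≤ 2⁻¹ * (2⁻¹ * T (fun h => 2 * F h + (2 * c * f h z.1 - 2 * c * a)) +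
          2⁻¹ * T (fun h => 2 * F' h - (2 * c * f h z.2 - 2 * c * a)) +
          (2⁻¹ * T (fun h => 2 * F h - (2 * c * f h z.1 - 2 * c * a)) +
          2⁻¹ * T (fun h => 2 * F' h + (2 * c * f h z.2 - 2 * c * a)))) := by
          gcongr
      _ = 2⁻¹ * (2⁻¹ * (T (fun h => 2 * F h + (2 * c * f h z.1 - 2 * c * a)) +
          T (fun h => 2 * F h - (2 * c * f h z.1 - 2 * c * a))) +
          2⁻¹ * (T (fun h => 2 * F' h + (2 * c * f h z.2 - 2 * c * a)) +
          T (fun h => 2 * F' h - (2 * c * f h z.2 - 2 * c * a)))) := by ring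
      _ ≤ _ := by
          gcongr
          · refine le_trans (le_of_eq ?_) (le_iSup (fun z : Z =>
              2⁻¹ * (T (fun h => 2 * F h + 2 * c * (f h z - a)) +
                T (fun h => 2 * F h - 2 * c * (f h z - a)))) z.1)
            simp only [mul_sub]
          · refine le_trans (le_of_eq ?_) (le_iSup (fun z : Z =>
              2⁻¹ * (T (fun h => 2 * F' h + 2 * c * (f h z - a)) +
                T (fun h => 2 * F' h - 2 * c * (f h z - a)))) z.2)
            simp only [mul_sub]

/-- The nested suprema choose each point after the earlier signs are revealed, and such a strategy
is precisely a tree. -/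
theorem treeSup_le_iSup_signAvg [Nonempty Z] (f : K → Z → ℝ) (c : ℝ) (n : ℕ) (F : K → ℝ) :
    treeSup f c n F ≤ ⨆ z : Tree Z n, signAvg n fun σ =>
      ⨆ h, ENNReal.ofReal (Real.exp (F h + c * ∑ t, sgn (σ t) * f h (z.along σ t))) := by
  induction n generalizing F with
  | zero =>
    refine le_iSup_of_le (Classical.arbitrary _) ?_
    simp [signAvg_zero, treeSup]
  | succ n ih =>
    refine iSup_le fun z => ?_
    rw [ENNReal.inv_mul_le_iff (by simp) (by simp)]
    refine (add_le_add (ih _) (ih _)).trans ?_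
    refine ENNReal.iSup_add_iSup_le fun zR zL => ?_
    rw [← ENNReal.inv_mul_le_iff (by simp) (by simp)]
    -- The two continuations are optimized separately, one subtree for each value of the first sign.
    refine le_iSup_of_le (Tree.node z fun b => if b then zR else zL) ?_
    rw [signAvg_succ]
    simp only [Fin.sum_univ_succ, Tree.along_node_zero, Tree.along_node_succ, Fin.cons_zero,
      Fin.cons_succ]
    simp only [sgn, if_true, Bool.false_eq_true, if_false, mul_add, one_mul, neg_mul, mul_neg,
      ← add_assoc, ← sub_eq_add_neg]
    exact le_rfl

/-- Azuma–Hoeffding for a martingale with increments `sgn (σ t) * u`, where `u` depends on earlier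
signs only: the root contributes `cosh (c * a) ≤ exp ((c * a) ^ 2 / 2)`, and induction handles the
subtrees. -/
theorem signAvg_exp_le {n : ℕ} {m : ℝ} (u : Tree ℝ n) (hu : ∀ t p, |u t p| ≤ m) (c : ℝ) :
    signAvg n (fun σ => ENNReal.ofReal (Real.exp (c * ∑ t, sgn (σ t) * u.along σ t))) ≤
      ENNReal.ofReal (Real.exp (n * (c * m) ^ 2 / 2)) := by
  induction n with
  | zero => simp [signAvg_zero]
  | succ n ih =>
    rw [signAvg_succ]
    simp only [Fin.sum_univ_succ, Tree.along_zero, Tree.along_cons_succ, Fin.cons_zero,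
      Fin.cons_succ, mul_add, Real.exp_add, ENNReal.ofReal_mul (Real.exp_pos _).le,
      signAvg_const_mul]
    set a := u 0 Fin.elim0
    have ha : |a| ≤ m := hu _ _
    set E := ENNReal.ofReal (Real.exp (n * (c * m) ^ 2 / 2))
    have hcosh : 2⁻¹ * (ENNReal.ofReal (Real.exp (c * (sgn true * a))) +
        ENNReal.ofReal (Real.exp (c * (sgn false * a)))) ≤
        ENNReal.ofReal (Real.exp ((c * m) ^ 2 / 2)) := by
      rw [← ENNReal.ofReal_add (Real.exp_pos _).le (Real.exp_pos _).le, ← ENNReal.ofReal_ofNat,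
        ← ENNReal.ofReal_inv_of_pos (by norm_num), ← ENNReal.ofReal_mul (by norm_num)]
      refine ENNReal.ofReal_le_ofReal ?_
      have h1 := Real.cosh_le_exp_half_sq (c * a)
      rw [Real.cosh_eq] at h1
      have h2 : Real.exp ((c * a) ^ 2 / 2) ≤ Real.exp ((c * m) ^ 2 / 2) := by
        rw [Real.exp_le_exp, mul_pow, mul_pow]
        have : a ^ 2 ≤ m ^ 2 := sq_le_sq' (abs_le.1 ha).1 (abs_le.1 ha).2
        gcongr
      simp only [sgn, if_true, Bool.false_eq_true, if_false, one_mul, neg_mul, mul_neg]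
      linarith
    calc _ ≤ 2⁻¹ * (ENNReal.ofReal (Real.exp (c * (sgn true * a))) * E +
          ENNReal.ofReal (Real.exp (c * (sgn false * a))) * E) := by
          rw [← mul_add]
          exact mul_le_mul_right (add_le_add
            (mul_le_mul_right (ih (u.sub true) fun t p => hu _ _) _)
            (mul_le_mul_right (ih (u.sub false) fun t p => hu _ _) _)) _
      _ = 2⁻¹ * (ENNReal.ofReal (Real.exp (c * (sgn true * a))) +
          ENNReal.ofReal (Real.exp (c * (sgn false * a)))) * E := by ring
      _ ≤ ENNReal.ofReal (Real.exp ((c * m) ^ 2 / 2)) * E := by gcongr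
      _ = _ := by
          rw [← ENNReal.ofReal_mul (Real.exp_pos _).le, ← Real.exp_add]
          congr 2
          push_cast
          ring

/-- Projection onto `[0, M]` brings a point no farther from the points of that interval. A cover may
contain unbounded trees; this allows them to be truncated without loss. -/
theorem abs_clamp_sub_le {M a b : ℝ} (hb : 0 ≤ b) (hbM : b ≤ M) :
    |max 0 (min M a) - b| ≤ |a - b| := by
  rcases le_total a 0 with h | h
  · rw [min_eq_right (by linarith), max_eq_left h, abs_sub_comm, abs_sub_comm a]
    rw [abs_of_nonneg (by linarith), abs_of_nonneg (by linarith)]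
    linarith
  · rcases le_total a M with h' | h'
    · rw [min_eq_right h', max_eq_right h]
    · rw [min_eq_left h', max_eq_right (by linarith), abs_of_nonneg (by linarith),
        abs_of_nonneg (by linarith)]
      linarith

/-- A finite cover on a tree bounds the exponential moment of the supremum of the Rademacher
process on this tree. -/
theorem signAvg_iSup_exp_le {n : ℕ} {f : K → Z → ℝ} {M : ℝ} (hf0 : ∀ h z, 0 ≤ f h z)
    (hfM : ∀ h z, f h z ≤ M) (z : Tree Z n) (V : Finset (Tree ℝ n)) {B : ℝ}
    (hV : ∀ h, ∀ σ : Fin n → Bool, ∃ v ∈ V,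
      ∑ t : Fin n, |v.along σ t - f h (z.along σ t)| ≤ B) (c : ℝ) :
    (signAvg n fun σ => ⨆ h, ENNReal.ofReal (Real.exp
      (c * ∑ t, sgn (σ t) * (f h (z.along σ t) - M / 2)))) ≤
      V.card * ENNReal.ofReal (Real.exp (|c| * B + n * (c * (M / 2)) ^ 2 / 2)) := by
  rcases isEmpty_or_nonempty K with hK | ⟨⟨h₀⟩⟩
  · simp [signAvg]
  -- With depth 0 the tree has no node at which `f` can be evaluated, so `0 ≤ M` is not available
  -- for the main argument.
  rcases n.eq_zero_or_pos with rfl | hn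
  · obtain ⟨v, hv, hvB⟩ := hV h₀ Fin.elim0
    have hB : 0 ≤ B := by simpa using hvB
    have hcard : (1 : ℝ≥0∞) ≤ V.card := by
      exact_mod_cast Finset.card_pos.2 ⟨v, hv⟩
    rw [signAvg_zero]
    refine iSup_le fun h => ?_
    calc _ ≤ (1 : ℝ≥0∞) * ENNReal.ofReal (Real.exp
          (|c| * B + (0 : ℕ) * (c * (M / 2)) ^ 2 / 2)) := by
          rw [one_mul]
          refine ENNReal.ofReal_le_ofReal (Real.exp_le_exp.2 ?_)
          simp only [Finset.univ_eq_empty, Finset.sum_empty, mul_zero, Nat.cast_zero, zero_mul,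
            zero_div, add_zero]
          positivity
      _ ≤ _ := by gcongr
  have hM : 0 ≤ M := by
    let σ : Fin n → Bool := fun _ => true
    exact (hf0 h₀ (z.along σ ⟨0, hn⟩)).trans (hfM _ _)
  -- Truncated to the range of `f` and centered, the cover trees have entries bounded by `M / 2`, as
  -- `signAvg_exp_le` requires.
  let u : Tree ℝ n → Tree ℝ n := fun v t p => max 0 (min M (v t p)) - M / 2
  have hu : ∀ v t p, |u v t p| ≤ M / 2 := by
    intro v t p
    rw [abs_le]
    have h1 : 0 ≤ max 0 (min M (v t p)) := le_max_left _ _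
    have h2 : max 0 (min M (v t p)) ≤ M := max_le hM (min_le_left _ _)
    constructor <;> simp only [u] <;> linarith
  calc _ ≤ signAvg n (fun σ => ∑ v ∈ V, ENNReal.ofReal (Real.exp (|c| * B)) *
        ENNReal.ofReal (Real.exp (c * ∑ t, sgn (σ t) * (u v).along σ t))) := by
        refine signAvg_mono fun σ => iSup_le fun h => ?_
        obtain ⟨v, hv, hvB⟩ := hV h σ
        refine le_trans ?_ (Finset.single_le_sum (f := fun v => ENNReal.ofReal (Real.exp (|c| * B)) *
          ENNReal.ofReal (Real.exp (c * ∑ t, sgn (σ t) * (u v).along σ t)))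
          (fun _ _ => zero_le) hv)
        rw [← ENNReal.ofReal_mul (Real.exp_pos _).le, ← Real.exp_add]
        refine ENNReal.ofReal_le_ofReal (Real.exp_le_exp.2 ?_)
        have h1 : c * ∑ t, sgn (σ t) * (f h (z.along σ t) - M / 2) -
            c * ∑ t, sgn (σ t) * (u v).along σ t =
            c * ∑ t, sgn (σ t) * (f h (z.along σ t) - M / 2 - (u v).along σ t) := by
          rw [← mul_sub, ← Finset.sum_sub_distrib]
          simp only [mul_sub]
        have h2 : |∑ t, sgn (σ t) * (f h (z.along σ t) - M / 2 - (u v).along σ t)| ≤ B := by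
          refine (Finset.abs_sum_le_sum_abs _ _).trans (le_trans ?_ hvB)
          refine Finset.sum_le_sum fun t _ => ?_
          rw [abs_mul, abs_sgn, one_mul, abs_sub_comm]
          have : (u v).along σ t - (f h (z.along σ t) - M / 2) =
              max 0 (min M (v.along σ t)) - f h (z.along σ t) := by
            simp only [Tree.along, u]
            ring
          rw [this]
          exact abs_clamp_sub_le (hf0 _ _) (hfM _ _)
        have h3 : c * ∑ t, sgn (σ t) * (f h (z.along σ t) - M / 2 - (u v).along σ t) ≤ |c| * B :=
          (le_abs_self _).trans (by rw [abs_mul]; gcongr)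
        linarith
    _ = ∑ v ∈ V, ENNReal.ofReal (Real.exp (|c| * B)) *
        signAvg n (fun σ => ENNReal.ofReal (Real.exp (c * ∑ t, sgn (σ t) * (u v).along σ t))) := by
        rw [signAvg_finset_sum]
        simp only [signAvg_const_mul]
    _ ≤ ∑ v ∈ V, ENNReal.ofReal (Real.exp (|c| * B)) *
        ENNReal.ofReal (Real.exp (n * (c * (M / 2)) ^ 2 / 2)) := by
        gcongr with v
        exact signAvg_exp_le _ (hu v) c
    _ = _ := by
        rw [Finset.sum_const, nsmul_eq_mul, ← ENNReal.ofReal_mul (Real.exp_pos _).le,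
          ← Real.exp_add]

theorem exists_finset_cover {P : Type} {L : P → Z → ℝ} {H : Set P} {α : ℝ} {n N : ℕ}
    (hN : seqCoverNumber L H α n ≤ N) (z : Tree Z n) :
    ∃ V : Finset (Tree ℝ n), IsSeqCover L H α z V ∧ V.card ≤ N := by
  have h1 : seqCoverNumberOn L H α z ≤ N := (le_iSup _ z).trans hN
  have h2 : seqCoverNumberOn L H α z < (N + 1 : ℕ) :=
    h1.trans_lt (by exact_mod_cast Nat.lt_succ_self N)
  unfold seqCoverNumberOn at h2
  simp only [iInf_lt_iff] at h2
  obtain ⟨V, hV, hlt⟩ := h2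
  have hfin : V.Finite := by
    rw [← Set.encard_lt_top_iff]
    exact hlt.trans_le le_top
  refine ⟨hfin.toFinset, by simpa using hV, ?_⟩
  rw [hfin.encard_eq_coe_toFinset_card] at hlt
  exact Nat.lt_succ_iff.1 (by exact_mod_cast hlt)

/-- The symmetrized worst case is controlled by the sequential covering number. -/
theorem pairSup_le_seqCoverNumber [Nonempty Z] {P : Type} {L : P → Z → ℝ} {H : Set P}
    (θ : K → P) (hθ : ∀ h, θ h ∈ H) {M : ℝ} (hL0 : ∀ h z, 0 ≤ L (θ h) z)
    (hLM : ∀ h z, L (θ h) z ≤ M) {α : ℝ} {n N : ℕ} (hN : seqCoverNumber L H α n ≤ N) (c : ℝ) :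
    pairSup (fun h => L (θ h)) c n 0 ≤
      N * ENNReal.ofReal (Real.exp (2 * |c| * (n * α) + n * (c * M) ^ 2 / 2)) := by
  -- Both halves coincide because both offsets are zero. Centering at `M / 2` turns the doubled
  -- parameter into `2 * c * (M / 2) = c * M`.
  have h1 := pairSup_le_treeSup (fun h => L (θ h)) (M / 2) c n 0 0
  simp only [Pi.zero_apply, add_zero, mul_zero] at h1
  rw [← two_mul, ← mul_assoc, ENNReal.inv_mul_cancel (by simp) (by simp), one_mul] at h1
  refine h1.trans ((treeSup_le_iSup_signAvg _ _ _ _).trans (iSup_le fun z => ?_))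
  obtain ⟨V, hV, hcard⟩ := exists_finset_cover hN z
  simp only [zero_add]
  refine (signAvg_iSup_exp_le hL0 hLM z V (fun h σ => hV (θ h) (hθ h) σ) (2 * c)).trans ?_
  have e : |2 * c| * (n * α) + n * (2 * c * (M / 2)) ^ 2 / 2 =
      2 * |c| * (n * α) + n * (c * M) ^ 2 / 2 := by
    rw [abs_mul, abs_two]
    ring
  rw [e]
  gcongr

end TreeBounds

/-! ### Uniform deviations -/

section Deviation

variable {K Z : Type} [MeasurableSpace K] [StandardBorelSpace K] [Nonempty K]
  [MeasurableSpace Z] [StandardBorelSpace Z] [Nonempty Z] {f : K → Z → ℝ}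
  {Ω : Type*} [MeasurableSpace Ω]

theorem aemeasurable_iSup_exp (hf : Measurable (Function.uncurry f)) (μ : Measure Ω)
    [IsProbabilityMeasure μ] {n : ℕ} {ζ : ℕ → Ω → Z} (hζ : ∀ i < n, Measurable (ζ i))
    {R : K → ℝ} (hR : Measurable R) (c : ℝ) :
    AEMeasurable (fun ω => ⨆ h, ENNReal.ofReal
      (Real.exp (c * ∑ i ∈ Finset.range n, (f h (ζ i ω) - R h)))) μ := by
  have hpast : Measurable fun ω (j : Fin n) => ζ j ω := measurable_pi_lambda _ fun j => hζ j j.2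
  have h1 : IsMeasurableSup fun y : Fin n → Z =>
      pairSup f c 0 (fun h => c * ∑ j : Fin n, (f h (y j) - R h)) := by
    refine isMeasurableSup_pairSup hf c 0
      (Measurable.const_mul (Finset.measurable_fun_sum _ fun j _ => ?_) c)
    exact (hf.comp (f := fun y : (Fin n → Z) × K => (y.2, y.1 j)) (by fun_prop)).sub
      (hR.comp measurable_snd)
  have h2 := (h1.aemeasurable (μ.map fun ω (j : Fin n) => ζ j ω)).comp_measurable hpast
  simpa only [Function.comp_def, pairSup, Finset.sum_range] using h2

/-- Chernoff's bound for one sign `s` of the deviation. The choice `|c| = t / M ^ 2` minimizes `n *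
(c * M) ^ 2 / 2 - |c| * n * t`, and the summand `2 * B` in the threshold cancels the covering error
`2 * |c| * B` in the exponent. -/
theorem measure_exists_lt_sum_le (hf : Measurable (Function.uncurry f)) {M : ℝ} (hM0 : 0 < M)
    (hM : ∀ h z, |f h z| ≤ M) (μ : Measure Ω) [IsProbabilityMeasure μ] {n : ℕ} {ζ : ℕ → Ω → Z}
    (hζ : ∀ i < n, Measurable (ζ i)) (κ : ℕ → Ω → Measure Z)
    (hκp : ∀ i ω, IsProbabilityMeasure (κ i ω))
    (hκ : ∀ i < n, ∀ g : (Fin i → Z) × Z → ℝ≥0∞, Measurable g →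
      ∫⁻ ω, g (fun j => ζ j ω, ζ i ω) ∂μ = ∫⁻ ω, ∫⁻ z, g (fun j => ζ j ω, z) ∂(κ i ω) ∂μ)
    {R : K → ℝ} (hR : ∀ i < n, ∀ ω h, ∫ z, f h z ∂(κ i ω) = R h) (hRm : Measurable R) {B : ℝ}
    {N : ℕ} (hU : ∀ c, pairSup f c n 0 ≤
      N * ENNReal.ofReal (Real.exp (2 * |c| * B + n * (c * M) ^ 2 / 2)))
    {t : ℝ} (ht : 0 ≤ t) {s : ℝ} (hs : |s| = 1) :
    μ {ω | ∃ h, 2 * B + n * t < s * ∑ i ∈ Finset.range n, (f h (ζ i ω) - R h)} ≤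
      N * ENNReal.ofReal (Real.exp (-(n * t ^ 2 / (2 * M ^ 2)))) := by
  set c := s * (t / M ^ 2) with hc
  have habs : |c| = t / M ^ 2 := by rw [hc, abs_mul, hs, one_mul, abs_of_nonneg (by positivity)]
  have h1 := lintegral_iSup_exp_le hf hM μ hζ κ hκp hκ hR c
  have h2 := aemeasurable_iSup_exp hf μ hζ hRm c
  set a := Real.exp (|c| * (2 * B + n * t))
  have ha : 0 < a := Real.exp_pos _
  have h3 := meas_ge_le_lintegral_div h2 (ε := ENNReal.ofReal a) (by simpa using ha) (by simp)
  refine (measure_mono ?_).trans (h3.trans ((ENNReal.div_le_div_right (h1.trans (hU c)) _).trans ?_))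
  · rintro ω ⟨h, hlt⟩
    refine le_trans ?_ (le_iSup (fun h => ENNReal.ofReal
      (Real.exp (c * ∑ i ∈ Finset.range n, (f h (ζ i ω) - R h)))) h)
    refine (ENNReal.ofReal_le_ofReal (Real.exp_le_exp.2 ?_))
    rw [habs, hc, mul_comm s, mul_assoc]
    gcongr
  · rw [mul_div_assoc, ← ENNReal.ofReal_div_of_pos ha, ← Real.exp_sub]
    refine le_of_eq ?_
    congr 3
    rw [mul_pow, ← sq_abs c, habs]
    field_simp
    ring

theorem measure_exists_lt_abs_sum_le (hf : Measurable (Function.uncurry f)) {M : ℝ} (hM0 : 0 < M)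
    (hM : ∀ h z, |f h z| ≤ M) (μ : Measure Ω) [IsProbabilityMeasure μ] {n : ℕ} {ζ : ℕ → Ω → Z}
    (hζ : ∀ i < n, Measurable (ζ i)) (κ : ℕ → Ω → Measure Z)
    (hκp : ∀ i ω, IsProbabilityMeasure (κ i ω))
    (hκ : ∀ i < n, ∀ g : (Fin i → Z) × Z → ℝ≥0∞, Measurable g →
      ∫⁻ ω, g (fun j => ζ j ω, ζ i ω) ∂μ = ∫⁻ ω, ∫⁻ z, g (fun j => ζ j ω, z) ∂(κ i ω) ∂μ)
    {R : K → ℝ} (hR : ∀ i < n, ∀ ω h, ∫ z, f h z ∂(κ i ω) = R h) (hRm : Measurable R) {B : ℝ}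
    {N : ℕ} (hU : ∀ c, pairSup f c n 0 ≤
      N * ENNReal.ofReal (Real.exp (2 * |c| * B + n * (c * M) ^ 2 / 2)))
    {t : ℝ} (ht : 0 ≤ t) :
    μ {ω | ∃ h, 2 * B + n * t < |∑ i ∈ Finset.range n, (f h (ζ i ω) - R h)|} ≤
      ENNReal.ofReal (2 * N * Real.exp (-(n * t ^ 2 / (2 * M ^ 2)))) := by
  have hp := measure_exists_lt_sum_le hf hM0 hM μ hζ κ hκp hκ hR hRm hU ht (s := 1) (by simp)
  have hm := measure_exists_lt_sum_le hf hM0 hM μ hζ κ hκp hκ hR hRm hU ht (s := -1) (by simp)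
  refine (measure_mono ?_).trans ((measure_union_le _ _).trans ((add_le_add hp hm).trans ?_))
  · rintro ω ⟨h, hlt⟩
    rcases lt_abs.1 hlt with h1 | h1
    · exact Or.inl ⟨h, by simpa using h1⟩
    · exact Or.inr ⟨h, by simpa using h1⟩
  · rw [← two_mul, ← mul_assoc, ENNReal.ofReal_mul (by positivity),
      ENNReal.ofReal_mul (by norm_num)]
    simp

end Deviation

/-! ### Measurability in the learning problem -/

section Model

variable {k d : ℕ} {X : Set (Fin k → ℝ)} {C : Set (Fin d → ℝ)}

theorem continuous_seminorm (N : Seminorm ℝ (Fin d → ℝ)) : Continuous N :=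
  continuousOn_univ.1 (N.convexOn.continuousOn isOpen_univ)

/-- An arbitrary infimum of continuous functions is upper semicontinuous, so an uncountable
degenerate set does no harm. -/
theorem measurable_distDegeneracy (N : Seminorm ℝ (Fin d → ℝ)) (S : Set (Fin d → ℝ)) :
    Measurable (distDegeneracy N S) := by
  refine measurable_of_Iio fun a => IsOpen.measurableSet ?_
  have : distDegeneracy N S ⁻¹' Set.Iio a =
      ⋃ c' ∈ degenerateSet S, {c | ENNReal.ofReal (N (c' - c)) < a} := by
    ext c
    simp [distDegeneracy, iInf_lt_iff]
  rw [this]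
  refine isOpen_biUnion fun c' _ => isOpen_lt ?_ continuous_const
  exact ENNReal.continuous_ofReal.comp
    ((continuous_seminorm N).comp (continuous_const.sub continuous_id))

/-- The importance weight of an observation. -/
def weight (p : ℝ) : Bool × Bool → ℝ
  | (true, _) => 1
  | (false, true) => 1 / p
  | (false, false) => 0

theorem rewLoss_eq_weight_mul (p : ℝ) (l : (Fin d → ℝ) → (Fin d → ℝ) → ℝ) (h : Predictor X d)
    (z : Obs X C) : rewLoss p l h z = weight p z.2.2 * l (h z.1) z.2.1 := by
  obtain ⟨x, c, b, q⟩ := z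
  cases b <;> cases q <;> simp [rewLoss, weight]

theorem weight_nonneg {p : ℝ} (hp : 0 < p) (b : Bool × Bool) : 0 ≤ weight p b := by
  obtain ⟨b, q⟩ := b
  cases b <;> cases q <;> simp [weight, hp.le]

theorem weight_le {p : ℝ} (hp : 0 < p) (hp1 : p ≤ 1) (b : Bool × Bool) : weight p b ≤ 1 / p := by
  have h1 : 1 ≤ 1 / p := (one_le_div hp).2 hp1
  obtain ⟨b, q⟩ := b
  cases b <;> cases q <;> simp only [weight] <;> linarith

/-- The hypothesis class as a space, with the topology of uniform convergence. -/
def HypSpace (H : Set (Predictor X d)) : Type :=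
  {f : X →ᵤ (Fin d → ℝ) // UniformFun.toFun f ∈ H}

instance (H : Set (Predictor X d)) : TopologicalSpace (HypSpace H) :=
  inferInstanceAs (TopologicalSpace {f : X →ᵤ (Fin d → ℝ) // UniformFun.toFun f ∈ H})

instance (H : Set (Predictor X d)) : MeasurableSpace (HypSpace H) := borel _

instance (H : Set (Predictor X d)) : BorelSpace (HypSpace H) := ⟨rfl⟩

/-- The predictor behind a point of the hypothesis space. -/
def HypSpace.pred {H : Set (Predictor X d)} (h : HypSpace H) : Predictor X d :=
  UniformFun.toFun h.1

theorem HypSpace.pred_mem {H : Set (Predictor X d)} (h : HypSpace H) : h.pred ∈ H := h.2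

theorem HypSpace.exists_pred_eq {H : Set (Predictor X d)} {g : Predictor X d} (hg : g ∈ H) :
    ∃ h : HypSpace H, h.pred = g := ⟨⟨UniformFun.ofFun g, hg⟩, rfl⟩

section

variable {H : Set (Predictor X d)}

instance HypSpace.metrizableSpace : TopologicalSpace.MetrizableSpace (HypSpace H) :=
  inferInstanceAs
    (TopologicalSpace.MetrizableSpace {f : X →ᵤ (Fin d → ℝ) // UniformFun.toFun f ∈ H})

/-- Compactness supplies separability and completeness, making the class a standard Borel parameter
space, as the measurable projection argument demands. -/
theorem HypSpace.polishSpace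
    (hHc : IsCompact {f : X →ᵤ (Fin d → ℝ) | UniformFun.toFun f ∈ H}) :
    PolishSpace (HypSpace H) := by
  have : CompactSpace (HypSpace H) := isCompact_iff_compactSpace.1 hHc
  let := TopologicalSpace.metrizableSpaceMetric (HypSpace H)
  infer_instance

/-- A Carathéodory function: evaluation is continuous in the predictor and measurable in the
feature. -/
theorem HypSpace.measurable_pred (hHm : ∀ g ∈ H, Measurable g)
    (hHc : IsCompact {f : X →ᵤ (Fin d → ℝ) | UniformFun.toFun f ∈ H}) :
    Measurable fun y : HypSpace H × X => y.1.pred y.2 := by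
  have := HypSpace.polishSpace hHc
  refine measurable_uncurry_of_continuous_of_measurable (u := fun (h : HypSpace H) x => h.pred x)
    (fun x => ?_) fun h => hHm _ h.pred_mem
  exact (UniformFun.uniformContinuous_eval (Fin d → ℝ) x).continuous.comp continuous_subtype_val

theorem measurable_rewLoss_pred (hHm : ∀ g ∈ H, Measurable g)
    (hHc : IsCompact {f : X →ᵤ (Fin d → ℝ) | UniformFun.toFun f ∈ H})
    {l : (Fin d → ℝ) → (Fin d → ℝ) → ℝ} (hlm : Measurable (Function.uncurry l)) (p : ℝ) :
    Measurable (Function.uncurry fun (h : HypSpace H) (z : Obs X C) => rewLoss p l h.pred z) := by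
  simp only [rewLoss_eq_weight_mul]
  refine Measurable.mul (f := fun y : HypSpace H × Obs X C => weight p y.2.2.2) ?_ ?_
  · exact (Measurable.of_discrete (f := weight p)).comp (by fun_prop)
  · refine hlm.comp (f := fun y : HypSpace H × Obs X C => (y.1.pred y.2.1, (y.2.2.1 : Fin d → ℝ)))
      (Measurable.prodMk ?_ (by fun_prop))
    exact (HypSpace.measurable_pred hHm hHc).comp
      (f := fun y : HypSpace H × Obs X C => (y.1, y.2.1)) (by fun_prop)

theorem loss_le_lossSup {l : (Fin d → ℝ) → (Fin d → ℝ) → ℝ}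
    (hlb : BddAbove (Set.image2 l (predictionSpace H) C)) {g : Predictor X d} (hg : g ∈ H) (x : X)
    (c : C) : l (g x) c ≤ lossSup l (predictionSpace H) C :=
  le_csSup hlb ⟨g x, ⟨g, hg, x, rfl⟩, c, c.2, rfl⟩

theorem rewLoss_nonneg {l : (Fin d → ℝ) → (Fin d → ℝ) → ℝ} (hl : ∀ a c, 0 ≤ l a c) {p : ℝ}
    (hp : 0 < p) (g : Predictor X d) (z : Obs X C) : 0 ≤ rewLoss p l g z := by
  rw [rewLoss_eq_weight_mul]
  exact mul_nonneg (weight_nonneg hp _) (hl _ _)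

theorem rewLoss_le {l : (Fin d → ℝ) → (Fin d → ℝ) → ℝ} (hl : ∀ a c, 0 ≤ l a c)
    (hlb : BddAbove (Set.image2 l (predictionSpace H) C)) {p : ℝ} (hp : 0 < p) (hp1 : p ≤ 1)
    {g : Predictor X d} (hg : g ∈ H) (z : Obs X C) :
    rewLoss p l g z ≤ lossSup l (predictionSpace H) C / p := by
  rw [rewLoss_eq_weight_mul, div_eq_mul_one_div, mul_comm]
  exact mul_le_mul (loss_le_lossSup hlb hg _ _) (weight_le hp hp1 _) (weight_nonneg hp _)
    ((hl _ _).trans (loss_le_lossSup hlb hg z.1 z.2.1))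

theorem measurable_risk {D : Measure (X × C)} [IsProbabilityMeasure D]
    {l : (Fin d → ℝ) → (Fin d → ℝ) → ℝ} (hlm : Measurable (Function.uncurry l)) {P : Type*}
    [MeasurableSpace P] {h : P → Predictor X d} (hh : Measurable fun y : P × X => h y.1 y.2) :
    Measurable fun y => risk D l (h y) := by
  refine StronglyMeasurable.measurable (StronglyMeasurable.integral_prod_right
    (f := fun (y : P) (z : X × C) => l (h y z.1) z.2) (Measurable.stronglyMeasurable ?_))
  refine hlm.comp (f := fun y : P × X × C => (h y.1 y.2.1, (y.2.2 : Fin d → ℝ)))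
    (Measurable.prodMk ?_ (by fun_prop))
  exact hh.comp (f := fun y : P × X × C => (y.1, y.2.1)) (by fun_prop)

end

end Model

/-! ### Conditional laws from independence -/

section Independence

variable {Ω Ω' W Y Z : Type*} [mΩ : MeasurableSpace Ω] [MeasurableSpace Ω'] [MeasurableSpace W]
  [MeasurableSpace Y] [MeasurableSpace Z]

theorem lintegral_comp_prodMk_of_indepFun {μ : Measure Ω} [IsProbabilityMeasure μ] {A : Ω → Ω'}
    {V : Ω → W} (hA : Measurable A) (hV : Measurable V) (h : IndepFun A V μ) {g : Ω' × W → ℝ≥0∞}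
    (hg : Measurable g) :
    ∫⁻ ω, g (A ω, V ω) ∂μ = ∫⁻ ω, ∫⁻ w, g (A ω, w) ∂(μ.map V) ∂μ := by
  have := Measure.isProbabilityMeasure_map hV.aemeasurable (μ := μ)
  have := Measure.isProbabilityMeasure_map hA.aemeasurable (μ := μ)
  rw [← lintegral_map hg (hA.prodMk hV), (indepFun_iff_map_prod_eq_prod_map_map hA.aemeasurable
    hV.aemeasurable).1 h, lintegral_prod _ hg.aemeasurable,
    lintegral_map (hg.lintegral_prod_right') hA]

theorem lintegral_comp_eq_of_indepFun {μ : Measure Ω} [IsProbabilityMeasure μ] {A : Ω → Ω'}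
    {V : Ω → W} (hA : Measurable A) (hV : Measurable V) (h : IndepFun A V μ) {past : Ω' → Y}
    (hpast : Measurable past) {ψ : Ω' × W → Z} (hψ : Measurable ψ) {g : Y × Z → ℝ≥0∞}
    (hg : Measurable g) :
    ∫⁻ ω, g (past (A ω), ψ (A ω, V ω)) ∂μ =
      ∫⁻ ω, ∫⁻ z, g (past (A ω), z) ∂((μ.map V).map fun w => ψ (A ω, w)) ∂μ := by
  rw [lintegral_comp_prodMk_of_indepFun hA hV h (g := fun y => g (past y.1, ψ y)) (by fun_prop)]
  refine lintegral_congr fun ω => ?_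
  exact (lintegral_map (f := fun z => g (past (A ω), z)) (hg.comp measurable_prodMk_left)
    (hψ.comp measurable_prodMk_left)).symm

/-- By Fubini an event with null sections is null. In the label bound this allows a comparison
predictor that depends on the past, with no measurable selection. -/
theorem measure_mem_eq_zero_of_indepFun {μ : Measure Ω} [IsProbabilityMeasure μ] {A : Ω → Ω'}
    {V : Ω → W} (hA : Measurable A) (hV : Measurable V) (h : IndepFun A V μ) {E : Set (Ω' × W)}
    (hE : MeasurableSet E) (hsec : ∀ a, μ.map V {v | (a, v) ∈ E} = 0) :
    μ {ω | (A ω, V ω) ∈ E} = 0 := by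
  have key := lintegral_comp_prodMk_of_indepFun hA hV h (measurable_one.indicator hE)
  have h1 : ∀ a, ∫⁻ v, E.indicator (1 : Ω' × W → ℝ≥0∞) (a, v) ∂(μ.map V) = 0 := fun a =>
    (lintegral_indicator_one (measurable_prodMk_left hE)).trans (hsec a)
  simp only [h1, lintegral_zero] at key
  exact (lintegral_indicator_one ((hA.prodMk hV) hE)).symm.trans key

/-- Encodes the whole past as one random variable, the identity map into `Ω` with the smaller
sigma-algebra, so that everything `𝒢`-measurable is a function of it. -/
theorem indepFun_id_of_indep {μ : Measure Ω} {𝒢 : MeasurableSpace Ω} {V : Ω → W}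
    (h : Indep (MeasurableSpace.comap V inferInstance) 𝒢 μ) :
    @IndepFun Ω Ω W mΩ 𝒢 _ id V μ := by
  have := h.symm
  rw [IndepFun_iff_Indep, MeasurableSpace.comap_id]
  exact this

end Independence

/-! ### The observations along a run of the algorithm -/

section Run

variable {k d : ℕ} {X : Set (Fin k → ℝ)} {C : Set (Fin d → ℝ)} {Ω : Type*}

open Classical in
/-- Whether the prediction for a feature is near degeneracy. -/
def nearMark (N : Seminorm ℝ (Fin d → ℝ)) (S : Set (Fin d → ℝ)) (b : ℝ)
    (h : Ω → Predictor X d) (y : Ω × X) : Bool :=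
  decide (distDegeneracy N S (h y.1 y.2) < ENNReal.ofReal b)

theorem measurable_nearMark (N : Seminorm ℝ (Fin d → ℝ)) (S : Set (Fin d → ℝ)) (b : ℝ)
    {m : MeasurableSpace Ω} {h : Ω → Predictor X d}
    (hh : Measurable fun y : Ω × X => h y.1 y.2) : Measurable (nearMark N S b h) := by
  refine measurable_to_bool ?_
  have : nearMark N S b h ⁻¹' {true} =
      {y | distDegeneracy N S (h y.1 y.2) < ENNReal.ofReal b} := by
    ext y
    simp [nearMark]
  rw [this]
  exact ((measurable_distDegeneracy N S).comp hh) measurableSet_Iio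

/-- The observation of an iteration, as a function of the past and of the fresh sample and coin. -/
def obsOf (mark : Ω × X → Bool) (y : Ω × (X × C) × Bool) : Obs X C :=
  (y.2.1.1, y.2.1.2, mark (y.1, y.2.1.1), y.2.2)

theorem measurable_obsOf {m : MeasurableSpace Ω} {mark : Ω × X → Bool} (hm : Measurable mark) :
    Measurable (obsOf (C := C) mark) := by
  unfold obsOf
  have : Measurable fun y : Ω × (X × C) × Bool => mark (y.1, y.2.1.1) :=
    hm.comp (f := fun y : Ω × (X × C) × Bool => (y.1, y.2.1.1)) (by fun_prop)
  fun_prop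

/-- The observation of a warm-up sample, which is always labeled. -/
def warmObs (y : X × C) : Obs X C := (y.1, y.2, true, true)

theorem measurable_warmObs : Measurable (warmObs (X := X) (C := C)) := by
  unfold warmObs
  fun_prop

/-- The observations in order, those of the warm-up period included. -/
def allObs (N : Seminorm ℝ (Fin d → ℝ)) (S : Set (Fin d → ℝ)) (n₀ : ℕ) (b : ℕ → ℝ)
    (ξ : ℕ → Ω → X × C) (q : ℕ → Ω → Bool) (h : ℕ → Ω → Predictor X d) (i : ℕ) (ω : Ω) :
    Obs X C :=
  if i < n₀ then warmObs (ξ i ω) else obs N S n₀ b ξ q h (i - n₀) ω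

variable {N : Seminorm ℝ (Fin d → ℝ)} {S : Set (Fin d → ℝ)} {n₀ : ℕ} {b : ℕ → ℝ}
  {ξ : ℕ → Ω → X × C} {q : ℕ → Ω → Bool} {h : ℕ → Ω → Predictor X d}

theorem obs_eq_obsOf (s : ℕ) (ω : Ω) : obs N S n₀ b ξ q h s ω =
    obsOf (nearMark N S (b s) (h s)) (ω, ξ (n₀ + s) ω, q s ω) := by
  simp only [obs, obsOf, nearMark, IsNear, Prod.mk.injEq, true_and, and_true]
  exact decide_eq_decide.2 Iff.rfl

theorem empRisk_eq_sum_allObs (l : (Fin d → ℝ) → (Fin d → ℝ) → ℝ) (p : ℝ) (t : ℕ)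
    (g : Predictor X d) (ω : Ω) : empRisk N S l p n₀ b ξ q h t g ω =
      (1 / ((t : ℝ) + n₀)) *
        ∑ i ∈ Finset.range (n₀ + t), rewLoss p l g (allObs N S n₀ b ξ q h i ω) := by
  unfold empRisk
  rw [Finset.sum_range_add]
  congr 2
  · refine Finset.sum_congr rfl fun i hi => ?_
    simp [allObs, Finset.mem_range.1 hi, warmObs, rewLoss]
  · refine Finset.sum_congr rfl fun i hi => ?_
    simp [allObs]

variable [mΩ : MeasurableSpace Ω] {μ : Measure Ω} {ℱ : Filtration ℕ mΩ} {D : Measure (X × C)}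
  {H : Set (Predictor X d)} {l : (Fin d → ℝ) → (Fin d → ℝ) → ℝ} {p : ℝ}

namespace IsRun

theorem measurable_warm_at (run : IsRun μ ℱ D N S H l p n₀ b ξ q h) {i : ℕ}
    (hi : i < n₀) (s : ℕ) : Measurable[ℱ s] (ξ i) :=
  (run.warm_meas i hi).mono (ℱ.mono (Nat.zero_le s)) le_rfl

theorem measurable_sample (run : IsRun μ ℱ D N S H l p n₀ b ξ q h) (i : ℕ) : Measurable (ξ i) := by
  rcases lt_or_ge i n₀ with hi | hi
  · exact (run.warm_meas i hi).mono (ℱ.le 0) le_rfl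
  · obtain ⟨s, rfl⟩ := Nat.exists_eq_add_of_le hi
    exact (run.sample_meas s).mono (ℱ.le _) le_rfl

theorem measurable_coin (run : IsRun μ ℱ D N S H l p n₀ b ξ q h) (s : ℕ) : Measurable (q s) := (run.coin_meas s).mono (ℱ.le _) le_rfl

theorem measurable_obs (run : IsRun μ ℱ D N S H l p n₀ b ξ q h) (s : ℕ) : Measurable[ℱ (s + 1)] (obs N S n₀ b ξ q h s) := by
  have h1 : @Measurable _ _ ((ℱ (s + 1)).prod inferInstance) _ (nearMark N S (b s) (h s)) :=
    measurable_nearMark N S (b s) (m := ℱ (s + 1))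
      ((run.pred_meas s).mono (sup_le_sup_right
        (MeasurableSpace.comap_mono (ℱ.mono (Nat.le_succ s))) _) le_rfl)
  have h2 := measurable_obsOf (C := C) (m := ℱ (s + 1)) h1
  have h3 := (@measurable_id _ (ℱ (s + 1))).prodMk ((run.sample_meas s).prodMk (run.coin_meas s))
  have h4 : obs N S n₀ b ξ q h s =
      fun ω => obsOf (nearMark N S (b s) (h s)) (id ω, ξ (n₀ + s) ω, q s ω) :=
    funext fun ω => obs_eq_obsOf s ω
  rw [h4]
  exact h2.comp h3

theorem measurable_allObs (run : IsRun μ ℱ D N S H l p n₀ b ξ q h) {i s : ℕ} (hi : i < n₀ + s) :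
    Measurable[ℱ s] (allObs N S n₀ b ξ q h i) := by
  unfold allObs
  split_ifs with h1
  · exact measurable_warmObs.comp (run.measurable_warm_at h1 s)
  · exact (run.measurable_obs (i - n₀)).mono (ℱ.mono (by omega)) le_rfl

theorem map_sample_coin [IsProbabilityMeasure μ]
    (run : IsRun μ ℱ D N S H l p n₀ b ξ q h) (s : ℕ) :
    μ.map (fun ω => (ξ (n₀ + s) ω, q s ω)) = D.prod (μ.map (q s)) := by
  rw [(indepFun_iff_map_prod_eq_prod_map_map (run.measurable_sample _).aemeasurable
    (run.measurable_coin s).aemeasurable).1 (run.sample_coin_indep s), run.law]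

theorem integral_coin [IsProbabilityMeasure μ]
    (run : IsRun μ ℱ D N S H l p n₀ b ξ q h) (hp : 0 ≤ p) (s : ℕ) (u : Bool → ℝ) :
    ∫ c, u c ∂(μ.map (q s)) = p * u true + (1 - p) * u false := by
  have := Measure.isProbabilityMeasure_map (run.measurable_coin s).aemeasurable (μ := μ)
  have h1 : (μ.map (q s)).real {true} = p := by
    rw [map_measureReal_apply (run.measurable_coin s) (MeasurableSet.singleton _), measureReal_def]
    have : q s ⁻¹' {true} = {ω | q s ω = true} := rfl
    rw [this, run.coin, ENNReal.toReal_ofReal hp]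
  have h2 : (μ.map (q s)).real {false} = 1 - p := by
    have := probReal_compl_eq_one_sub (μ := μ.map (q s)) (MeasurableSet.singleton true)
    rw [h1] at this
    rw [← this]
    congr 1
    ext c
    cases c <;> simp
  rw [integral_fintype .of_finite, Fintype.sum_bool, h1, h2]
  simp

theorem indepFun_past (run : IsRun μ ℱ D N S H l p n₀ b ξ q h) (s : ℕ) :
    @IndepFun Ω Ω _ mΩ (ℱ s) _ id (fun ω => (ξ (n₀ + s) ω, q s ω)) μ :=
  indepFun_id_of_indep (run.fresh s)

end IsRun

end Run

/-! ### Uniform deviation of the re-weighted risk along a run -/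

section RunDeviation

variable {k d : ℕ} {X : Set (Fin k → ℝ)} {C : Set (Fin d → ℝ)} {Ω : Type*}
  {N : Seminorm ℝ (Fin d → ℝ)} {S : Set (Fin d → ℝ)} {n₀ : ℕ} {b : ℕ → ℝ}
  {ξ : ℕ → Ω → X × C} {q : ℕ → Ω → Bool} {h : ℕ → Ω → Predictor X d}
  [mΩ : MeasurableSpace Ω] {μ : Measure Ω} {ℱ : Filtration ℕ mΩ} {D : Measure (X × C)}
  {H : Set (Predictor X d)} {l : (Fin d → ℝ) → (Fin d → ℝ) → ℝ} {p : ℝ}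

/-- The conditional law of an observation given the past. -/
def obsLaw (N : Seminorm ℝ (Fin d → ℝ)) (S : Set (Fin d → ℝ)) (n₀ : ℕ) (b : ℕ → ℝ)
    (ξ : ℕ → Ω → X × C) (q : ℕ → Ω → Bool) (h : ℕ → Ω → Predictor X d) (μ : Measure Ω)
    (i : ℕ) (ω : Ω) : Measure (Obs X C) :=
  if i < n₀ then (μ.map (ξ i)).map warmObs
  else (μ.map fun ω => (ξ (n₀ + (i - n₀)) ω, q (i - n₀) ω)).map
    fun y => obsOf (nearMark N S (b (i - n₀)) (h (i - n₀))) (ω, y)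

namespace IsRun

theorem measurable_obsOf_nearMark (run : IsRun μ ℱ D N S H l p n₀ b ξ q h) (s : ℕ) :
    @Measurable _ _ ((ℱ s).prod inferInstance) _
      (obsOf (X := X) (C := C) (nearMark N S (b s) (h s))) :=
  measurable_obsOf (m := ℱ s) (measurable_nearMark N S (b s) (m := ℱ s) (run.pred_meas s))

theorem measurable_obsOf_nearMark_mk (run : IsRun μ ℱ D N S H l p n₀ b ξ q h) (s : ℕ) (ω : Ω) :
    Measurable fun y : (X × C) × Bool => obsOf (nearMark N S (b s) (h s)) (ω, y) :=
  (run.measurable_obsOf_nearMark s).comp (@measurable_prodMk_left _ _ (ℱ s) _ ω)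

theorem isProbabilityMeasure_obsLaw [IsProbabilityMeasure μ]
    (run : IsRun μ ℱ D N S H l p n₀ b ξ q h) (i : ℕ) (ω : Ω) :
    IsProbabilityMeasure (obsLaw N S n₀ b ξ q h μ i ω) := by
  unfold obsLaw
  split_ifs
  · have := Measure.isProbabilityMeasure_map (run.measurable_sample i).aemeasurable (μ := μ)
    exact Measure.isProbabilityMeasure_map measurable_warmObs.aemeasurable
  · have := Measure.isProbabilityMeasure_map ((run.measurable_sample (n₀ + (i - n₀))).prodMk
      (run.measurable_coin (i - n₀))).aemeasurable (μ := μ)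
    exact Measure.isProbabilityMeasure_map (run.measurable_obsOf_nearMark_mk _ _).aemeasurable

/-- Unbiasedness of importance weighting. The mark depends only on the past and the feature; where
it is false, the coin yields `p * (1 / p) = 1` because it is independent of the sample. Hence
neither thresholds nor earlier predictors affect the conditional mean. -/
theorem integral_obsLaw [IsProbabilityMeasure μ] [IsProbabilityMeasure D]
    (run : IsRun μ ℱ D N S H l p n₀ b ξ q h)
    (hl : ∀ a c, 0 ≤ l a c) (hlm : Measurable (Function.uncurry l))
    (hlb : BddAbove (Set.image2 l (predictionSpace H) C)) (hp : 0 < p) (hp1 : p ≤ 1)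
    {g : Predictor X d} (hg : g ∈ H) (hgm : Measurable g) (i : ℕ) (ω : Ω) :
    ∫ z, rewLoss p l g z ∂(obsLaw N S n₀ b ξ q h μ i ω) = risk D l g := by
  have hlg : Measurable fun z : X × C => l (g z.1) z.2 :=
    hlm.comp (f := fun z : X × C => (g z.1, (z.2 : Fin d → ℝ)))
      ((hgm.comp measurable_fst).prodMk (by fun_prop))
  have hm : Measurable fun z : Obs X C => rewLoss p l g z := by
    simp only [rewLoss_eq_weight_mul]
    exact ((Measurable.of_discrete (f := weight p)).comp (by fun_prop)).mul
      (hlg.comp (f := fun z : Obs X C => (z.1, z.2.1)) (by fun_prop))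
  unfold obsLaw
  split_ifs with hi
  · rw [integral_map measurable_warmObs.aemeasurable hm.aestronglyMeasurable, run.law]
    simp [risk, warmObs, rewLoss]
  · have hψ := run.measurable_obsOf_nearMark_mk (i - n₀) ω
    rw [integral_map hψ.aemeasurable hm.aestronglyMeasurable, run.map_sample_coin]
    have := Measure.isProbabilityMeasure_map (run.measurable_coin (i - n₀)).aemeasurable (μ := μ)
    rw [integral_prod]
    · unfold risk
      congr 1
      ext y
      rw [run.integral_coin hp.le]
      simp only [obsOf]
      cases nearMark N S (b (i - n₀)) (h (i - n₀)) (ω, y.1)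
      · simp only [rewLoss]
        field_simp
        ring
      · simp only [rewLoss]
        ring
    · refine .of_bound (hm.comp hψ).aestronglyMeasurable
        (lossSup l (predictionSpace H) C / p) (ae_of_all _ fun y => ?_)
      rw [Real.norm_eq_abs, abs_of_nonneg (rewLoss_nonneg hl hp _ _)]
      exact rewLoss_le hl hlb hp hp1 hg _

/-- Identifies `obsLaw` as the conditional law given earlier observations. In the warm-up this rests
on mutual independence of the samples; afterwards the earlier observations are `ℱ s`-measurable and
the new sample and coin are jointly independent of `ℱ s`. -/
theorem lintegral_allObs [IsProbabilityMeasure μ]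
    (run : IsRun μ ℱ D N S H l p n₀ b ξ q h) (i : ℕ) {g : (Fin i → Obs X C) × Obs X C → ℝ≥0∞}
    (hg : Measurable g) :
    ∫⁻ ω, g (fun j => allObs N S n₀ b ξ q h j ω, allObs N S n₀ b ξ q h i ω) ∂μ =
      ∫⁻ ω, ∫⁻ z, g (fun j => allObs N S n₀ b ξ q h j ω, z)
        ∂(obsLaw N S n₀ b ξ q h μ i ω) ∂μ := by
  rcases lt_or_ge i n₀ with hi | hi
  · let I : Finset (Fin n₀) := Finset.univ.filter fun j => (j : ℕ) < i
    have hmem : ∀ j : Fin i, (⟨j, j.2.trans hi⟩ : Fin n₀) ∈ I := fun j => by simp [I]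
    have hind := run.warm_indep.indepFun_finset I {⟨i, hi⟩} (by simp [I])
      fun j => run.measurable_sample j
    have hind2 : IndepFun (fun ω (j : I) => ξ j ω) (ξ i) μ :=
      hind.comp (ψ := fun y : (({⟨i, hi⟩} : Finset (Fin n₀)) → X × C) =>
        y ⟨⟨i, hi⟩, Finset.mem_singleton_self _⟩) measurable_id (measurable_pi_apply _)
    have key := lintegral_comp_eq_of_indepFun
      (measurable_pi_lambda _ fun j : I => run.measurable_sample j) (run.measurable_sample i) hind2
      (past := fun (y : I → X × C) (j : Fin i) => warmObs (y ⟨⟨j, j.2.trans hi⟩, hmem j⟩))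
      (measurable_pi_lambda _ fun j => measurable_warmObs.comp (measurable_pi_apply _))
      (ψ := fun y : (I → X × C) × (X × C) => warmObs y.2)
      (measurable_warmObs.comp measurable_snd) hg
    have hlt : ∀ j : Fin i, (j : ℕ) < n₀ := fun j => j.2.trans hi
    simpa only [allObs, obsLaw, hi, hlt, if_true] using key
  · obtain ⟨s, rfl⟩ := Nat.exists_eq_add_of_le hi
    have hpast : @Measurable _ _ (ℱ s) _
        fun ω (j : Fin (n₀ + s)) => allObs N S n₀ b ξ q h j ω :=
      @measurable_pi_lambda _ _ _ (ℱ s) _ _ fun j => run.measurable_allObs j.2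
    have key := @lintegral_comp_eq_of_indepFun Ω Ω _ _ _ mΩ (ℱ s) _ _ _ μ _ id _
      (measurable_id.mono (ℱ.le s) le_rfl)
      ((run.measurable_sample (n₀ + s)).prodMk (run.measurable_coin s)) (run.indepFun_past s)
      _ hpast _ (run.measurable_obsOf_nearMark s) _ hg
    have hnot : ¬ n₀ + s < n₀ := by omega
    have hobs : ∀ ω, allObs N S n₀ b ξ q h (n₀ + s) ω =
        obsOf (nearMark N S (b s) (h s)) (ω, ξ (n₀ + s) ω, q s ω) := fun ω => by
      simp only [allObs, hnot, if_false, Nat.add_sub_cancel_left, obs_eq_obsOf]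
    simpa only [hobs, obsLaw, hnot, if_false, Nat.add_sub_cancel_left, id] using key

/-- The uniform deviation bound for the re-weighted risk. -/
theorem measure_deviation [IsProbabilityMeasure μ] [IsProbabilityMeasure D]
    (run : IsRun μ ℱ D N S H l p n₀ b ξ q h) (hX : MeasurableSet X) (hC : MeasurableSet C)
    (hHm : ∀ g ∈ H, Measurable g)
    (hHc : IsCompact {f : X →ᵤ (Fin d → ℝ) | UniformFun.toFun f ∈ H}) (hHne : H.Nonempty)
    (hl : ∀ a c, 0 ≤ l a c) (hlm : Measurable (Function.uncurry l))
    (hlb : BddAbove (Set.image2 l (predictionSpace H) C)) (hp : 0 < p) (hp1 : p ≤ 1)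
    (hω : 0 < lossSup l (predictionSpace H) C) {n m : ℕ} (hn : 1 ≤ n)
    (hm : coverNum C p l H n ≤ m) {τ : ℝ} (hτ : 0 ≤ τ) :
    μ {ω | ∃ g ∈ H, 2 * lossSup l (predictionSpace H) C + n * τ <
        |∑ i ∈ Finset.range n, (rewLoss p l g (allObs N S n₀ b ξ q h i ω) - risk D l g)|} ≤
      ENNReal.ofReal (2 * m * Real.exp
        (-(n * τ ^ 2 / (2 * (lossSup l (predictionSpace H) C / p) ^ 2)))) := by
  have := HypSpace.polishSpace hHc
  have : Nonempty (HypSpace H) := by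
    obtain ⟨g, hg⟩ := hHne
    exact ⟨(HypSpace.exists_pred_eq hg).choose⟩
  have := hX.standardBorel
  have := hC.standardBorel
  have hne : Nonempty (X × C) := nonempty_of_isProbabilityMeasure D
  have : Nonempty X := hne.map Prod.fst
  have : Nonempty C := hne.map Prod.snd
  have hf := measurable_rewLoss_pred (C := C) hHm hHc hlm p
  set ω₀ := lossSup l (predictionSpace H) C with hω₀
  have h0 : ∀ (h : HypSpace H) (z : Obs X C), 0 ≤ rewLoss p l h.pred z :=
    fun h z => rewLoss_nonneg hl hp _ _
  have hM : ∀ (h : HypSpace H) (z : Obs X C), rewLoss p l h.pred z ≤ ω₀ / p :=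
    fun h z => rewLoss_le hl hlb hp hp1 h.pred_mem z
  have hRm : Measurable fun h : HypSpace H => risk D l h.pred :=
    measurable_risk hlm (HypSpace.measurable_pred hHm hHc)
  -- Covering at scale `ω₀ / n` costs `n * (ω₀ / n) = ω₀` in total over the `n` observations, which
  -- explains `B`.
  have key := measure_exists_lt_abs_sum_le (B := ω₀) (N := m) hf (div_pos hω hp)
    (fun h z => by rw [abs_of_nonneg (h0 h z)]; exact hM h z) μ (n := n)
    (ζ := allObs N S n₀ b ξ q h)
    (fun i hi => (run.measurable_allObs (s := n) (by omega)).mono (ℱ.le _) le_rfl)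
    (obsLaw N S n₀ b ξ q h μ) run.isProbabilityMeasure_obsLaw
    (fun i _ g hg => run.lintegral_allObs i hg)
    (fun i _ ω g => run.integral_obsLaw hl hlm hlb hp hp1 g.pred_mem (hHm _ g.pred_mem) i ω)
    hRm (fun c => by
      have := pairSup_le_seqCoverNumber (Z := Obs X C) (HypSpace.pred (H := H)) HypSpace.pred_mem
        h0 hM hm c
      have hn' : (n : ℝ) ≠ 0 := by positivity
      rwa [mul_div_cancel₀ _ hn'] at this) hτ
  refine (measure_mono ?_).trans key
  rintro ω ⟨g, hg, hlt⟩
  obtain ⟨g', rfl⟩ := HypSpace.exists_pred_eq hg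
  exact ⟨g', hlt⟩

end IsRun

end RunDeviation

/-! ### The surrogate risk along a run -/

section SurrogateRisk

variable {k d : ℕ} {X : Set (Fin k → ℝ)} {C : Set (Fin d → ℝ)}
  {D : Measure (X × C)} {H : Set (Predictor X d)} {l : (Fin d → ℝ) → (Fin d → ℝ) → ℝ}

theorem optRisk_eq_risk {g : Predictor X d} (hg : g ∈ minimizers D l H) :
    optRisk D l H = risk D l g :=
  IsLeast.csInf_eq ⟨⟨g, hg.1, rfl⟩, by rintro _ ⟨g', hg', rfl⟩; exact hg.2 g' hg'⟩

theorem lossSup_nonneg (hl : ∀ a c, 0 ≤ l a c) (A : Set (Fin d → ℝ)) : 0 ≤ lossSup l A C :=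
  Real.sSup_nonneg (by rintro _ ⟨a, -, c, -, rfl⟩; exact hl a c)

theorem risk_eq_zero (hl : ∀ a c, 0 ≤ l a c)
    (hlb : BddAbove (Set.image2 l (predictionSpace H) C))
    (hω : lossSup l (predictionSpace H) C = 0) {g : Predictor X d} (hg : g ∈ H) :
    risk D l g = 0 := by
  have : ∀ z : X × C, l (g z.1) z.2 = 0 := fun z =>
    le_antisymm (hω ▸ loss_le_lossSup hlb hg z.1 z.2) (hl _ _)
  simp [risk, this]

variable {Ω : Type*} {N : Seminorm ℝ (Fin d → ℝ)} {S : Set (Fin d → ℝ)} {n₀ : ℕ} {b : ℕ → ℝ}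
  {ξ : ℕ → Ω → X × C} {q : ℕ → Ω → Bool} {h : ℕ → Ω → Predictor X d}
  [mΩ : MeasurableSpace Ω] {μ : Measure Ω} {ℱ : Filtration ℕ mΩ} {p δ : ℝ}

namespace IsRun

/-- Empirical risk minimization: the uniform deviation bound is applied once to `h t` and once to a
true minimizer, whence the factor 2, and the empirical comparison between them has the right sign.
-/
theorem measure_lt_risk_sub_optRisk [IsProbabilityMeasure μ] [IsProbabilityMeasure D]
    (run : IsRun μ ℱ D N S H l p n₀ b ξ q h) (hX : MeasurableSet X) (hC : MeasurableSet C)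
    (hHm : ∀ g ∈ H, Measurable g)
    (hHc : IsCompact {f : X →ᵤ (Fin d → ℝ) | UniformFun.toFun f ∈ H})
    (hne : (minimizers D l H).Nonempty)
    (hl : ∀ a c, 0 ≤ l a c) (hlm : Measurable (Function.uncurry l))
    (hlb : BddAbove (Set.image2 l (predictionSpace H) C)) (hp : 0 < p) (hp1 : p ≤ 1)
    (hω : 0 < lossSup l (predictionSpace H) C) (hn₀ : 1 ≤ n₀) {t m : ℕ}
    (hm : coverNum C p l H (t + n₀) ≤ m) {τ : ℝ} (hτ : 0 ≤ τ) :
    μ {ω | 2 * (τ + 2 * lossSup l (predictionSpace H) C / (t + n₀ : ℕ)) <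
        risk D l (h t ω) - optRisk D l H} ≤
      ENNReal.ofReal (2 * m * Real.exp
        (-((t + n₀ : ℕ) * τ ^ 2 / (2 * (lossSup l (predictionSpace H) C / p) ^ 2)))) := by
  obtain ⟨g, hg⟩ := hne
  refine le_trans (measure_mono_ae ?_) (run.measure_deviation hX hC hHm hHc ⟨g, hg.1⟩ hl hlm hlb
    hp hp1 hω (n := t + n₀) (by omega) hm hτ)
  filter_upwards [run.pred_min] with ω hω' hlt
  set n := t + n₀ with hn
  have hnpos : (0 : ℝ) < n := by
    have : 0 < n := by omega
    exact_mod_cast this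
  set w := lossSup l (predictionSpace H) C
  replace hlt : 2 * (τ + 2 * w / n) < risk D l (h t ω) - optRisk D l H := hlt
  rw [optRisk_eq_risk hg] at hlt
  by_contra hcon
  change ¬ ∃ g ∈ H, 2 * w + n * τ < |∑ i ∈ Finset.range n,
    (rewLoss p l g (allObs N S n₀ b ξ q h i ω) - risk D l g)| at hcon
  push Not at hcon
  have hemp : ∀ g' : Predictor X d, empRisk N S l p n₀ b ξ q h t g' ω = (1 / (n : ℝ)) *
      ∑ i ∈ Finset.range n, rewLoss p l g' (allObs N S n₀ b ξ q h i ω) := fun g' => by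
    rw [empRisk_eq_sum_allObs, hn, add_comm n₀ t]
    push_cast
    rfl
  have h1 := (abs_le.1 (hcon _ (run.pred_mem t ω))).1
  have h2 := (abs_le.1 (hcon g hg.1)).2
  have h3 := hω' t g hg.1
  rw [hemp, hemp] at h3
  have h4 := le_of_mul_le_mul_left h3 (by positivity)
  simp only [Finset.sum_sub_distrib, Finset.sum_const, Finset.card_range, nsmul_eq_mul] at h1 h2
  have h5 : n * (risk D l (h t ω) - risk D l g) ≤ n * (2 * (τ + 2 * w / n)) := by
    have : n * (2 * (τ + 2 * w / n)) = 2 * (2 * w + n * τ) := by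
      field_simp
      ring
    rw [this]
    linarith
  exact absurd (le_of_mul_le_mul_left h5 hnpos) (not_le.2 hlt)

/-- Here `τ` solves `2 * m * exp (-(n * τ ^ 2 / (2 * (w / p) ^ 2))) = δ`. The deviation bound needs
a positive loss supremum; when it is zero, all risks vanish. -/
theorem measure_fixedRadius_lt [IsProbabilityMeasure μ] [IsProbabilityMeasure D]
    (run : IsRun μ ℱ D N S H l p n₀ b ξ q h) (hX : MeasurableSet X) (hC : MeasurableSet C)
    (hHm : ∀ g ∈ H, Measurable g)
    (hHc : IsCompact {f : X →ᵤ (Fin d → ℝ) | UniformFun.toFun f ∈ H})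
    (hne : (minimizers D l H).Nonempty)
    (hl : ∀ a c, 0 ≤ l a c) (hlm : Measurable (Function.uncurry l))
    (hlb : BddAbove (Set.image2 l (predictionSpace H) C)) (hp : 0 < p) (hp1 : p ≤ 1)
    (hδ : 0 < δ) (hδ1 : δ ≤ 1) (hn₀ : 1 ≤ n₀) (hfin : ∀ n ≥ n₀, coverNum C p l H n ≠ ⊤) (t : ℕ) :
    μ {ω | fixedRadius C p δ l H n₀ t < risk D l (h t ω) - optRisk D l H} ≤
      ENNReal.ofReal δ := by
  rcases (lossSup_nonneg (C := C) hl (predictionSpace H)).eq_or_lt with hω | hω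
  · obtain ⟨g, hg⟩ := hne
    have : {ω | fixedRadius C p δ l H n₀ t < risk D l (h t ω) - optRisk D l H} = ∅ := by
      ext ω
      simp [fixedRadius, ← hω, optRisk_eq_risk hg, risk_eq_zero hl hlb hω.symm hg.1,
        risk_eq_zero hl hlb hω.symm (run.pred_mem t ω)]
    simp [this]
  set w := lossSup l (predictionSpace H) C
  set n := t + n₀ with hn
  have hnpos : (0 : ℝ) < n := by
    have : 0 < n := by omega
    exact_mod_cast this
  set m := (coverNum C p l H n).toNat with hm
  have hcov : coverNum C p l H n ≤ m := (ENat.natCast_toNat (hfin n (by omega))).ge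
  set τ := w / p * √(2 * Real.log (2 * m / δ) / n) with hτ
  have key := run.measure_lt_risk_sub_optRisk hX hC hHm hHc hne hl hlm hlb hp hp1 hω hn₀ hcov
    (τ := τ) (by positivity)
  have hrad : fixedRadius C p δ l H n₀ t = 2 * (τ + 2 * w / n) := by
    simp only [fixedRadius, hτ]
    ring
  rw [hrad]
  refine key.trans (ENNReal.ofReal_le_ofReal ?_)
  rcases Nat.eq_zero_or_pos m with hm0 | hm0
  · rw [hm0]
    simp [hδ.le]
  have hm1 : (1 : ℝ) ≤ m := by exact_mod_cast hm0
  have hL : 0 ≤ Real.log (2 * m / δ) := Real.log_nonneg (by rw [le_div_iff₀ hδ]; linarith)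
  have he : n * τ ^ 2 / (2 * (w / p) ^ 2) = Real.log (2 * m / δ) := by
    rw [hτ, mul_pow, Real.sq_sqrt (by positivity)]
    field_simp
  rw [he, Real.exp_neg, Real.exp_log (by positivity)]
  apply le_of_eq
  field_simp

/-- The constant 4 in the radius doubles the exponent to `2 * log (2 * n * m / δ)`. This leaves `δ ^
2 / (2 * n ^ 2 * m)`, at most `δ / (2 * n ^ 2)` because `δ ≤ 1 ≤ m`, and this is summable in `n`. -/
theorem measure_radius_lt [IsProbabilityMeasure μ] [IsProbabilityMeasure D]
    (run : IsRun μ ℱ D N S H l p n₀ b ξ q h) (hX : MeasurableSet X) (hC : MeasurableSet C)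
    (hHm : ∀ g ∈ H, Measurable g)
    (hHc : IsCompact {f : X →ᵤ (Fin d → ℝ) | UniformFun.toFun f ∈ H})
    (hne : (minimizers D l H).Nonempty)
    (hl : ∀ a c, 0 ≤ l a c) (hlm : Measurable (Function.uncurry l))
    (hlb : BddAbove (Set.image2 l (predictionSpace H) C)) (hp : 0 < p) (hp1 : p ≤ 1)
    (hδ : 0 < δ) (hδ1 : δ ≤ 1) (hn₀ : 1 ≤ n₀) (hfin : ∀ n ≥ n₀, coverNum C p l H n ≠ ⊤) (t : ℕ) :
    μ {ω | radius C p δ l H n₀ t < risk D l (h t ω) - optRisk D l H} ≤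
      ENNReal.ofReal (δ / 2 * (1 / ((t + n₀ : ℕ) : ℝ) ^ 2)) := by
  rcases (lossSup_nonneg (C := C) hl (predictionSpace H)).eq_or_lt with hω | hω
  · obtain ⟨g, hg⟩ := hne
    have : {ω | radius C p δ l H n₀ t < risk D l (h t ω) - optRisk D l H} = ∅ := by
      ext ω
      simp [radius, ← hω, optRisk_eq_risk hg, risk_eq_zero hl hlb hω.symm hg.1,
        risk_eq_zero hl hlb hω.symm (run.pred_mem t ω)]
    simp [this]
  set w := lossSup l (predictionSpace H) C
  set n := t + n₀ with hn
  have hn1 : (1 : ℝ) ≤ n := by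
    have : 1 ≤ n := by omega
    exact_mod_cast this
  have hnpos : (0 : ℝ) < n := by linarith
  set m := (coverNum C p l H n).toNat with hm
  have hcov : coverNum C p l H n ≤ m := (ENat.natCast_toNat (hfin n (by omega))).ge
  set τ := w / p * √(4 * Real.log (2 * n * m / δ) / n) with hτ
  have key := run.measure_lt_risk_sub_optRisk hX hC hHm hHc hne hl hlm hlb hp hp1 hω hn₀ hcov
    (τ := τ) (by positivity)
  have hrad : radius C p δ l H n₀ t = 2 * (τ + 2 * w / n) := by
    simp only [radius, hτ]
    ring
  rw [hrad]
  refine key.trans (ENNReal.ofReal_le_ofReal ?_)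
  rcases Nat.eq_zero_or_pos m with hm0 | hm0
  · rw [hm0]
    simp only [CharP.cast_eq_zero, mul_zero, zero_mul]
    positivity
  have hm1 : (1 : ℝ) ≤ m := by exact_mod_cast hm0
  have hL : 0 ≤ Real.log (2 * n * m / δ) :=
    Real.log_nonneg (by rw [le_div_iff₀ hδ]; nlinarith)
  have he : n * τ ^ 2 / (2 * (w / p) ^ 2) = Real.log (2 * n * m / δ) + Real.log (2 * n * m / δ) := by
    rw [hτ, mul_pow, Real.sq_sqrt (by positivity)]
    field_simp
    ring
  rw [he, Real.exp_neg, Real.exp_add, Real.exp_log (by positivity)]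
  have : 2 * m * (2 * n * m / δ * (2 * n * m / δ))⁻¹ = δ / 2 * (1 / (n : ℝ) ^ 2) * (δ / m) := by
    field_simp
  rw [this]
  refine mul_le_of_le_one_right (by positivity) ?_
  rw [div_le_one (by positivity)]
  linarith

end IsRun

theorem tsum_ofReal_half_mul_inv_sq_le (hδ : 0 < δ) :
    ∑' T : ℕ, ENNReal.ofReal (δ / 2 * (1 / (T : ℝ) ^ 2)) ≤ ENNReal.ofReal δ := by
  have h := (hasSum_zeta_two).mul_left (δ / 2)
  rw [← ENNReal.ofReal_tsum_of_nonneg (fun T => by positivity) h.summable, h.tsum_eq]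
  refine ENNReal.ofReal_le_ofReal ?_
  -- The series sums to `(δ / 2) * (π ^ 2 / 6)`.
  have h1 : Real.pi ^ 2 ≤ 12 := by nlinarith [Real.pi_lt_d2, Real.pi_pos]
  nlinarith

end SurrogateRisk

/-! ### Stability of the optimization oracle -/

section Oracle

variable {d : ℕ} {S : Set (Fin d → ℝ)} {w : (Fin d → ℝ) → (Fin d → ℝ)}

theorem eq_of_mem_optimalSolutions {c u v : Fin d → ℝ} (hc : c ∉ degenerateSet S)
    (hu : u ∈ optimalSolutions S c) (hv : v ∈ optimalSolutions S c) : u = v := by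
  by_contra hne
  exact hc ⟨u, hu, v, hv, hne⟩

/-- A unique optimal solution over a polyhedron is determined by its active constraints. -/
theorem eq_of_active_eq {m : ℕ} {A : Fin m → Fin d → ℝ} {β : Fin m → ℝ}
    (hS : S = {w | ∀ j, A j ⬝ᵥ w ≤ β j}) {c v v' : Fin d → ℝ} (hc : c ∉ degenerateSet S)
    (hv : v ∈ optimalSolutions S c) (hv' : v' ∈ S)
    (hact : ∀ j, A j ⬝ᵥ v = β j ↔ A j ⬝ᵥ v' = β j) : v' = v := by
  have hmem : ∀ u, u ∈ S ↔ ∀ j, A j ⬝ᵥ u ≤ β j := fun u => by rw [hS]; rfl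
  -- A small step from `v` away from `v'` stays feasible: common active constraints remain
  -- equalities, the others have slack. Optimality of `v` against this point forces `v'` to cost no
  -- more than `v`.
  have hev : ∀ᶠ ε in 𝓝[>] (0 : ℝ), ∀ j, A j ⬝ᵥ (v - ε • (v' - v)) ≤ β j := by
    rw [eventually_all]
    intro j
    by_cases hj : A j ⬝ᵥ v = β j
    · refine Eventually.of_forall fun ε => ?_
      rw [dotProduct_sub, dotProduct_smul, dotProduct_sub, hj, (hact j).1 hj]
      simp
    · have hlt : A j ⬝ᵥ v < β j := lt_of_le_of_ne ((hmem v).1 hv.1 j) hj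
      have hcont : Continuous fun ε : ℝ => A j ⬝ᵥ (v - ε • (v' - v)) := by
        simp only [dotProduct_sub, dotProduct_smul]
        fun_prop
      have : ∀ᶠ ε in 𝓝 (0 : ℝ), A j ⬝ᵥ (v - ε • (v' - v)) < β j :=
        hcont.continuousAt.eventually_lt continuousAt_const (by simpa using hlt)
      exact (this.filter_mono nhdsWithin_le_nhds).mono fun _ => le_of_lt
  obtain ⟨ε, hε, hε0⟩ := (hev.and self_mem_nhdsWithin).exists
  have h1 := hv.2 _ ((hmem _).2 hε)
  rw [dotProduct_sub, dotProduct_smul, smul_eq_mul] at h1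
  have h2 : c ⬝ᵥ (v' - v) ≤ 0 := by
    by_contra hcon
    have := mul_pos (Set.mem_Ioi.1 hε0) (not_le.1 hcon)
    linarith
  rw [dotProduct_sub] at h2
  exact eq_of_mem_optimalSolutions hc
    ⟨hv', fun u hu => (sub_nonpos.1 h2).trans (hv.2 u hu)⟩ hv

/-- The oracle is constant along a segment of nondegenerate cost vectors. -/
theorem oracle_eq_of_segment (hS : IsPolyhedron S) (hw : ∀ c, w c ∈ optimalSolutions S c)
    {c c' : Fin d → ℝ}
    (hseg : ∀ r ∈ Set.Icc (0 : ℝ) 1, c + r • (c' - c) ∉ degenerateSet S) : w c' = w c := by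
  obtain ⟨m, A, β, hS⟩ := hS
  let f : Set.Icc (0 : ℝ) 1 → (Fin d → ℝ) := fun r => w (c + (r : ℝ) • (c' - c))
  -- There are finitely many sets of active constraints, and each determines the optimum.
  have hfin : (Set.range f).Finite := by
    refine Set.Finite.of_finite_image (f := fun v => {j | A j ⬝ᵥ v = β j}) (Set.toFinite _) ?_
    rintro _ ⟨r, rfl⟩ _ ⟨r', rfl⟩ hact
    refine (eq_of_active_eq hS (hseg r r.2) (hw _) (hw _).1 fun j => ?_).symm
    exact Set.ext_iff.1 hact j
  -- By uniqueness the oracle returns `v` exactly where `v` is optimal, a condition given by closed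
  -- inequalities in `r`. Finitely many disjoint closed fibres covering the interval are also open,
  -- so connectedness leaves only one.
  have hclosed : ∀ v ∈ Set.range f, IsClosed (f ⁻¹' {v}) := by
    rintro _ ⟨r₀, rfl⟩
    have : f ⁻¹' {f r₀} = ⋂ u ∈ S, {r : Set.Icc (0 : ℝ) 1 |
        (c + (r : ℝ) • (c' - c)) ⬝ᵥ f r₀ ≤ (c + (r : ℝ) • (c' - c)) ⬝ᵥ u} := by
      ext r
      simp only [Set.mem_preimage, Set.mem_singleton_iff, Set.mem_iInter, Set.mem_ofPred_eq]
      constructor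
      · intro h u hu
        rw [← h]
        exact (hw _).2 u hu
      · intro h
        exact eq_of_mem_optimalSolutions (hseg r r.2) (hw _) ⟨(hw _).1, h⟩
    rw [this]
    refine isClosed_biInter fun u _ => isClosed_le ?_ ?_ <;>
    · simp only [add_dotProduct, smul_dotProduct]
      fun_prop
  have hloc : IsLocallyConstant f := by
    rw [IsLocallyConstant.iff_isOpen_fiber]
    intro v
    have : f ⁻¹' {v} = (⋃ u ∈ Set.range f \ {v}, f ⁻¹' {u})ᶜ := by
      ext r
      simp only [Set.mem_preimage, Set.mem_singleton_iff, Set.mem_compl_iff, Set.mem_iUnion,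
        not_exists]
      constructor
      · intro h u hu hru
        exact hu.2 (hru.symm.trans h)
      · intro h
        by_contra hne
        exact h (f r) ⟨⟨r, rfl⟩, hne⟩ rfl
    rw [this, isOpen_compl_iff]
    exact (hfin.subset Set.sdiff_subset).isClosed_biUnion fun u hu => hclosed u hu.1
  have : PreconnectedSpace (Set.Icc (0 : ℝ) 1) := Subtype.preconnectedSpace isPreconnected_Icc
  have h01 := hloc.apply_eq_of_preconnectedSpace ⟨1, by simp⟩ ⟨0, by simp⟩
  simpa [f] using h01

/-- Each point of the segment is within `N (c' - c)` of `c`, too close to be degenerate. -/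
theorem oracle_eq_of_lt_distDegeneracy (hS : IsPolyhedron S)
    (hw : ∀ c, w c ∈ optimalSolutions S c) (N : Seminorm ℝ (Fin d → ℝ)) {c c' : Fin d → ℝ}
    (h : ENNReal.ofReal (N (c' - c)) < distDegeneracy N S c) : w c' = w c := by
  refine oracle_eq_of_segment hS hw fun r hr hdeg => not_le.2 h ?_
  refine (iInf₂_le _ hdeg).trans (ENNReal.ofReal_le_ofReal ?_)
  rw [add_sub_cancel_left, map_smul_eq_mul, Real.norm_eq_abs, abs_of_nonneg hr.1]
  exact mul_le_of_le_one_left (apply_nonneg N _) hr.2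

theorem distDegeneracy_le_add (N : Seminorm ℝ (Fin d → ℝ)) (S : Set (Fin d → ℝ))
    (c c' : Fin d → ℝ) :
    distDegeneracy N S c' ≤ distDegeneracy N S c + ENNReal.ofReal (N (c - c')) := by
  unfold distDegeneracy
  simp only [ENNReal.iInf_add]
  refine iInf₂_mono fun a ha => ?_
  rw [← ENNReal.ofReal_add (apply_nonneg N _) (apply_nonneg N _)]
  refine ENNReal.ofReal_le_ofReal ?_
  rw [← sub_add_sub_cancel a c c']
  exact map_add_le_add N _ _

theorem linGap_eq (hw : ∀ c, w c ∈ optimalSolutions S c) (c : Fin d → ℝ) :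
    linGap S c = c ⬝ᵥ w (-c) - c ⬝ᵥ w c := by
  have h1 : IsGreatest ((fun u => c ⬝ᵥ u) '' S) (c ⬝ᵥ w (-c)) := by
    refine ⟨⟨_, (hw _).1, rfl⟩, ?_⟩
    rintro _ ⟨u, hu, rfl⟩
    have := (hw (-c)).2 u hu
    simpa using this
  have h2 : IsLeast ((fun u => c ⬝ᵥ u) '' S) (c ⬝ᵥ w c) := by
    refine ⟨⟨_, (hw _).1, rfl⟩, ?_⟩
    rintro _ ⟨u, hu, rfl⟩
    exact (hw c).2 u hu
  rw [linGap, h1.csSup_eq, h2.csInf_eq]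

/-- Boundedness of `S` is not assumed; it follows from attained minima for the costs `±eᵢ`, which
bound every coordinate on both sides. -/
theorem exists_abs_le_of_oracle (hw : ∀ c, w c ∈ optimalSolutions S c) :
    ∃ B, ∀ u ∈ S, ∀ i, |u i| ≤ B := by
  have hcoord : ∀ i, ∃ B, ∀ u ∈ S, |u i| ≤ B := by
    intro i
    refine ⟨max |w (Pi.single i 1) i| |w (-Pi.single i 1) i|, fun u hu => ?_⟩
    have h1 := (hw (Pi.single i 1)).2 u hu
    have h2 := (hw (-Pi.single i 1)).2 u hu
    simp only [neg_dotProduct, single_dotProduct, one_mul, neg_le_neg_iff] at h1 h2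
    exact abs_le_max_abs_abs h1 h2
  choose B hB using hcoord
  refine ⟨∑ i, |B i|, fun u hu i => (hB i u hu).trans ((le_abs_self _).trans ?_)⟩
  exact Finset.single_le_sum (f := fun i => |B i|) (fun _ _ => abs_nonneg _) (Finset.mem_univ i)

theorem bddAbove_linGap (hw : ∀ c, w c ∈ optimalSolutions S c) {C : Set (Fin d → ℝ)}
    (hC : Bornology.IsBounded C) : BddAbove (linGap S '' C) := by
  obtain ⟨B, hB⟩ := exists_abs_le_of_oracle hw
  obtain ⟨B', hB'⟩ := hC.exists_norm_le
  refine ⟨∑ _i : Fin d, B' * B + ∑ _i : Fin d, B' * B, ?_⟩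
  rintro _ ⟨c, hc, rfl⟩
  have key : ∀ u ∈ S, |c ⬝ᵥ u| ≤ ∑ _i : Fin d, B' * B := fun u hu => by
    refine (Finset.abs_sum_le_sum_abs _ _).trans (Finset.sum_le_sum fun i _ => ?_)
    rw [abs_mul]
    exact mul_le_mul ((norm_le_pi_norm c i).trans (hB' c hc)) (hB u hu i) (abs_nonneg _)
      ((norm_nonneg c).trans (hB' c hc))
  rw [linGap_eq hw]
  linarith [(abs_le.1 (key _ (hw (-c)).1)).2, (abs_le.1 (key _ (hw c).1)).1]

theorem dotProduct_sub_le_linGapSup (hw : ∀ c, w c ∈ optimalSolutions S c) {C : Set (Fin d → ℝ)}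
    (hC : Bornology.IsBounded C) {c u v : Fin d → ℝ} (hc : c ∈ C) (hu : u ∈ S) (hv : v ∈ S) :
    c ⬝ᵥ u - c ⬝ᵥ v ≤ linGapSup S C := by
  refine le_trans ?_ (le_csSup (bddAbove_linGap hw hC) ⟨c, hc, rfl⟩)
  rw [linGap_eq hw]
  have h1 := (hw (-c)).2 u hu
  have h2 := (hw c).2 v hv
  simp only [neg_dotProduct, neg_le_neg_iff] at h1
  linarith

end Oracle

/-! ### Surrogate risk controls the SPO risk -/

section Excess

variable {k d : ℕ} {X : Set (Fin k → ℝ)} {C : Set (Fin d → ℝ)} {D : Measure (X × C)}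
  {N : Seminorm ℝ (Fin d → ℝ)} {S : Set (Fin d → ℝ)} {H : Set (Predictor X d)}
  {l : (Fin d → ℝ) → (Fin d → ℝ) → ℝ} {w : (Fin d → ℝ) → (Fin d → ℝ)}

/-- The distance to the minimizers is an infimum that need not be attained, so a strict bound is
needed to select one. For positive `r`, `2 * φ r ≤ b` with `b > 0` gives `φ r < b`. The error bound
says nothing at excess zero, so for `r = 0` a small positive `ε` is used, with `φ ε → 0`. -/
theorem exists_minimizer_near {φ : ℝ → ℝ} (hφ : φ =O[𝓝[>] 0] Real.sqrt)
    (herr : ∀ g ∈ H, ∀ ε > 0, risk D l g - optRisk D l H ≤ ε →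
      distTo N D (minimizers D l H) g ≤ ENNReal.ofReal (φ ε))
    {g : Predictor X d} (hg : g ∈ H) {r b : ℝ} (hr : 0 ≤ r) (hb : 0 < b) (hφr : 2 * φ r ≤ b)
    (hgr : risk D l g - optRisk D l H ≤ r) :
    ∃ g' ∈ minimizers D l H, ∀ᵐ x ∂(D.map Prod.fst), N (g x - g' x) < b := by
  have hlt : distTo N D (minimizers D l H) g < ENNReal.ofReal b := by
    obtain ⟨ε, hε, hrε, hφε⟩ : ∃ ε > 0, r ≤ ε ∧ φ ε < b := by
      rcases hr.eq_or_lt with rfl | hr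
      · have h1 : Tendsto Real.sqrt (𝓝[>] 0) (𝓝 0) := by
          have := (Real.continuous_sqrt.tendsto 0).mono_left (nhdsWithin_le_nhds (s := Set.Ioi 0))
          simpa using this
        have h2 := hφ.trans_tendsto h1
        obtain ⟨ε, hε, hε0⟩ := ((h2.eventually (gt_mem_nhds hb)).and self_mem_nhdsWithin).exists
        exact ⟨ε, hε0, le_of_lt hε0, hε⟩
      · exact ⟨r, hr, le_rfl, by linarith⟩
    exact (herr g hg ε hε (hgr.trans hrε)).trans_lt ((ENNReal.ofReal_lt_ofReal_iff hb).2 hφε)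
  simp only [distTo, iInf_lt_iff] at hlt
  obtain ⟨g', hg', hlt⟩ := hlt
  refine ⟨g', hg', (ae_lt_of_essSup_lt hlt).mono fun x hx => ?_⟩
  exact (ENNReal.ofReal_lt_ofReal_iff hb).1 hx

theorem spoLoss_mem_Icc (hw : ∀ c, w c ∈ optimalSolutions S c) (hC : Bornology.IsBounded C)
    (a : Fin d → ℝ) (c : C) : spoLoss w a c ∈ Set.Icc 0 (linGapSup S C) :=
  ⟨sub_nonneg.2 ((hw _).2 _ (hw _).1), dotProduct_sub_le_linGapSup hw hC c.2 (hw _).1 (hw _).1⟩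

theorem integrable_spoLoss [IsProbabilityMeasure D] (hw : ∀ c, w c ∈ optimalSolutions S c)
    (hwm : Measurable w) (hC : Bornology.IsBounded C) {g : Predictor X d} (hg : Measurable g) :
    Integrable (fun z : X × C => spoLoss w (g z.1) z.2) D := by
  refine .of_bound (Measurable.aestronglyMeasurable ?_) (linGapSup S C) (ae_of_all _ fun z => ?_)
  · have h1 : Measurable fun z : X × C => w (g z.1) := hwm.comp (hg.comp measurable_fst)
    have h2 : Measurable fun z : X × C => w z.2 := hwm.comp (by fun_prop)
    have h3 : Measurable fun y : (Fin d → ℝ) × (Fin d → ℝ) × (Fin d → ℝ) =>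
        y.1 ⬝ᵥ y.2.1 - y.1 ⬝ᵥ y.2.2 := by
      unfold dotProduct
      fun_prop
    exact h3.comp (f := fun z : X × C => ((z.2 : Fin d → ℝ), w (g z.1), w z.2))
      ((measurable_subtype_coe.comp measurable_snd).prodMk (h1.prodMk h2))
  · have := spoLoss_mem_Icc hw hC (g z.1) z.2
    rw [Real.norm_eq_abs, abs_of_nonneg this.1]
    exact this.2

/-- Where `g'` is farther than `b` from degeneracy, both predictors induce the same decision and the
losses cancel; elsewhere they differ by at most `linGapSup S C`. The exceptional set has radius `b`
only, and is enlarged to `2 * b`. -/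
theorem risk_spoLoss_sub_le [IsProbabilityMeasure D] (hS : IsPolyhedron S)
    (hw : ∀ c, w c ∈ optimalSolutions S c) (hwm : Measurable w) (hC : Bornology.IsBounded C)
    (hHm : ∀ g ∈ H, Measurable g) {g g' : Predictor X d} (hg : g ∈ H)
    (hg' : g' ∈ minimizers D (spoLoss w) H) {b : ℝ} (hb : 0 < b)
    (hgg' : ∀ᵐ x ∂(D.map Prod.fst), N (g x - g' x) < b) :
    risk D (spoLoss w) g - optRisk D (spoLoss w) H ≤
      nearDegeneracy N S D (minimizers D (spoLoss w) H) (2 * b) * linGapSup S C := by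
  have hgm := hHm g hg
  have hgm' := hHm g' hg'.1
  obtain ⟨z₀⟩ : Nonempty (X × C) := nonempty_of_isProbabilityMeasure D
  have hω : 0 ≤ linGapSup S C :=
    (spoLoss_mem_Icc hw hC (w z₀.2) z₀.2).1.trans (spoLoss_mem_Icc hw hC _ z₀.2).2
  let A : Set X := {x | distDegeneracy N S (g' x) ≤ ENNReal.ofReal b}
  have hA : MeasurableSet A := ((measurable_distDegeneracy N S).comp hgm') measurableSet_Iic
  have hA' : MeasurableSet (Prod.fst ⁻¹' A : Set (X × C)) := hA.preimage measurable_fst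
  rw [optRisk_eq_risk hg']
  unfold risk
  rw [← integral_sub (integrable_spoLoss hw hwm hC hgm) (integrable_spoLoss hw hwm hC hgm')]
  have hae : ∀ᵐ z : X × C ∂D, spoLoss w (g z.1) z.2 - spoLoss w (g' z.1) z.2 ≤
      (Prod.fst ⁻¹' A).indicator (fun _ => linGapSup S C) z := by
    filter_upwards [ae_of_ae_map measurable_fst.aemeasurable hgg'] with z hz
    by_cases hzA : z ∈ (Prod.fst ⁻¹' A : Set (X × C))
    · rw [Set.indicator_of_mem hzA]
      linarith [(spoLoss_mem_Icc hw hC (g z.1) z.2).2, (spoLoss_mem_Icc hw hC (g' z.1) z.2).1]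
    · rw [Set.indicator_of_notMem hzA]
      have h1 : ENNReal.ofReal (N (g z.1 - g' z.1)) < distDegeneracy N S (g' z.1) :=
        (ENNReal.ofReal_le_ofReal hz.le).trans_lt (not_le.1 hzA)
      simp [spoLoss, oracle_eq_of_lt_distDegeneracy hS hw N h1]
  calc _ ≤ ∫ z : X × C, (Prod.fst ⁻¹' A).indicator (fun _ => linGapSup S C) z ∂D :=
        integral_mono_ae ((integrable_spoLoss hw hwm hC hgm).sub
          (integrable_spoLoss hw hwm hC hgm')) ((integrable_const _).indicator hA') hae
    _ = (D.map Prod.fst).real A * linGapSup S C := by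
        rw [integral_indicator_const _ hA', map_measureReal_apply measurable_fst hA, smul_eq_mul]
    _ ≤ _ := by
        have := Measure.isProbabilityMeasure_map (μ := D) (measurable_fst (α := X) (β := C)).aemeasurable
        refine mul_le_mul_of_nonneg_right (measureReal_mono fun x hx => ?_) hω
        exact (iInf₂_le g' hg').trans
          (le_trans (show _ ≤ _ from hx) (ENNReal.ofReal_le_ofReal (by linarith)))

end Excess

/-! ### The expected number of labels -/

section Labels

variable {k d : ℕ} {X : Set (Fin k → ℝ)} {C : Set (Fin d → ℝ)} {Ω : Type*}
  {N : Seminorm ℝ (Fin d → ℝ)} {S : Set (Fin d → ℝ)} {n₀ : ℕ} {b : ℕ → ℝ}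
  {ξ : ℕ → Ω → X × C} {q : ℕ → Ω → Bool} {h : ℕ → Ω → Predictor X d}

open Classical in
theorem labelCount_eq_sum (T : ℕ) (ω : Ω) : (labelCount N S n₀ b ξ q h T ω : ℝ) =
    ∑ s ∈ Finset.range T,
      {ω | IsNear N S n₀ b ξ h s ω ∨ q s ω = true}.indicator (1 : Ω → ℝ) ω := by
  simp [labelCount, Set.indicator_apply, Finset.sum_boole]

variable {D : Measure (X × C)} {H H' : Set (Predictor X d)} {l : (Fin d → ℝ) → (Fin d → ℝ) → ℝ}
  {p : ℝ}

theorem measurableSet_low_risk_inter_near [IsProbabilityMeasure D]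
    (N : Seminorm ℝ (Fin d → ℝ)) (S : Set (Fin d → ℝ)) (hlm : Measurable (Function.uncurry l))
    {P : Type*} [mP : MeasurableSpace P] {h : P → Predictor X d}
    (hh : Measurable fun y : P × X => h y.1 y.2) {a : ℝ} {b : ℝ≥0∞} {T : Set X}
    (hT : MeasurableSet T) :
    MeasurableSet {y : P × X | risk D l (h y.1) - optRisk D l H ≤ a ∧
      distDegeneracy N S (h y.1 y.2) < b ∧ y.2 ∉ T} := by
  have h1 : MeasurableSet {y : P × X | risk D l (h y.1) - optRisk D l H ≤ a} :=
    (((measurable_risk hlm hh).sub_const _) measurableSet_Iic).preimage measurable_fst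
  have h2 : MeasurableSet {y : P × X | distDegeneracy N S (h y.1 y.2) < b} :=
    ((measurable_distDegeneracy N S).comp hh) measurableSet_Iio
  exact h1.inter (h2.inter (hT.compl.preimage measurable_snd))

variable [mΩ : MeasurableSpace Ω] {μ : Measure Ω} {ℱ : Filtration ℕ mΩ}

namespace IsRun

theorem measurableSet_isNear (run : IsRun μ ℱ D N S H l p n₀ b ξ q h) (s : ℕ) :
    MeasurableSet {ω | IsNear N S n₀ b ξ h s ω} := by
  have h1 := ((run.measurable_obs s).mono (ℱ.le _) le_rfl).snd.snd.fst
    (measurableSet_singleton true)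
  have h2 : {ω | IsNear N S n₀ b ξ h s ω} =
      (fun ω => (obs N S n₀ b ξ q h s ω).2.2.1) ⁻¹' {true} := by
    ext ω
    simp [obs]
  rw [h2]
  exact h1

/-- If predictors of small surrogate risk are near `H'`, an iteration is near degeneracy with
probability at most the near-degeneracy function of `H'`, up to the failure of the risk bound. -/
theorem measure_isNear_le [IsProbabilityMeasure μ] [IsProbabilityMeasure D]
    (run : IsRun μ ℱ D N S H l p n₀ b ξ q h) (hlm : Measurable (Function.uncurry l)) {s : ℕ}
    (hb : 0 < b s) {r : ℝ}
    (hnear : ∀ g ∈ H, risk D l g - optRisk D l H ≤ r →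
      ∃ g' ∈ H', ∀ᵐ x ∂(D.map Prod.fst), N (g x - g' x) < b s) :
    μ {ω | IsNear N S n₀ b ξ h s ω} ≤ ENNReal.ofReal (nearDegeneracy N S D H' (2 * b s)) +
      μ {ω | r < risk D l (h s ω) - optRisk D l H} := by
  have hprob := Measure.isProbabilityMeasure_map (μ := D)
    (measurable_fst (α := X) (β := C)).aemeasurable
  set P := D.map Prod.fst with hP
  set A : Set X := {x | (⨅ g ∈ H', distDegeneracy N S (g x)) ≤ ENNReal.ofReal (2 * b s)} with hA
  -- The infimum over `H'` may be uncountable, so `A` need not be measurable; its measurable hull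
  -- has the same probability.
  let T := toMeasurable P A
  have hT : MeasurableSet T := measurableSet_toMeasurable _ _
  let E : Set (Ω × X) := {y | risk D l (h s y.1) - optRisk D l H ≤ r ∧
    distDegeneracy N S (h s y.1 y.2) < ENNReal.ofReal (b s) ∧ y.2 ∉ T}
  have hE : @MeasurableSet _ ((ℱ s).prod inferInstance) E :=
    measurableSet_low_risk_inter_near (mP := ℱ s) N S hlm (run.pred_meas s) hT
  -- For a fixed past of small risk, `h s ω` is within `b s` of some `g'` almost everywhere. A
  -- prediction within `b s` of degeneracy then places `g'` within `2 * b s`, hence the feature in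
  -- `A`, so almost no feature lies outside the hull.
  have hsec : ∀ ω, P {x | (ω, x) ∈ E} = 0 := by
    intro ω
    by_cases hω : risk D l (h s ω) - optRisk D l H ≤ r
    · obtain ⟨g', hg', hae⟩ := hnear _ (run.pred_mem s ω) hω
      refine measure_mono_null ?_ hae
      rintro x ⟨-, hx, hxT⟩ hlt
      have hle : distDegeneracy N S (g' x) ≤ ENNReal.ofReal (2 * b s) := by
        rw [two_mul, ENNReal.ofReal_add hb.le hb.le]
        exact (distDegeneracy_le_add N S (h s ω x) (g' x)).trans
          (add_le_add hx.le (ENNReal.ofReal_le_ofReal (le_of_lt hlt)))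
      have hxA : (⨅ g ∈ H', distDegeneracy N S (g x)) ≤ ENNReal.ofReal (2 * b s) :=
        (iInf₂_le (f := fun (g : Predictor X d) _ => distDegeneracy N S (g x)) g' hg').trans hle
      exact hxT (subset_toMeasurable P A hxA)
    · have : {x | (ω, x) ∈ E} = ∅ := by
        ext x
        exact ⟨fun hx => hω hx.1, fun hx => hx.elim⟩
      rw [this, measure_empty]
  have hmap : μ.map (fun ω => (ξ (n₀ + s) ω).1) = P := by
    rw [hP, ← run.law (n₀ + s), Measure.map_map measurable_fst (run.measurable_sample _)]
    rfl
  have hV : Measurable fun ω => (ξ (n₀ + s) ω).1 := (run.measurable_sample _).fst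
  have hind : @IndepFun Ω Ω X mΩ (ℱ s) _ id (fun ω => (ξ (n₀ + s) ω).1) μ :=
    @IndepFun.comp Ω Ω _ Ω X mΩ μ id _ (ℱ s) _ (ℱ s) _ id (fun y : (X × C) × Bool => y.1.1)
      (run.indepFun_past s) (@measurable_id _ (ℱ s)) (by fun_prop)
  have hnull : μ {ω | (ω, (ξ (n₀ + s) ω).1) ∈ E} = 0 :=
    @measure_mem_eq_zero_of_indepFun Ω Ω X mΩ (ℱ s) _ μ _ id _
      (measurable_id.mono (ℱ.le s) le_rfl) hV hind E hE (by simpa only [hmap] using hsec)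
  have hTm : μ {ω | (ξ (n₀ + s) ω).1 ∈ T} = ENNReal.ofReal (nearDegeneracy N S D H' (2 * b s)) := by
    have h1 : μ {ω | (ξ (n₀ + s) ω).1 ∈ T} = P T := by
      rw [← hmap, Measure.map_apply hV hT]
      rfl
    rw [h1, measure_toMeasurable, nearDegeneracy, ofReal_measureReal]
  calc μ {ω | IsNear N S n₀ b ξ h s ω}
      ≤ μ ({ω | (ξ (n₀ + s) ω).1 ∈ T} ∪ {ω | (ω, (ξ (n₀ + s) ω).1) ∈ E} ∪
          {ω | r < risk D l (h s ω) - optRisk D l H}) := by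
        refine measure_mono fun ω hω => ?_
        by_cases h1 : r < risk D l (h s ω) - optRisk D l H
        · exact Or.inr h1
        · by_cases h2 : (ξ (n₀ + s) ω).1 ∈ T
          · exact Or.inl (Or.inl h2)
          · exact Or.inl (Or.inr ⟨not_lt.1 h1, hω, h2⟩)
    _ ≤ μ {ω | (ξ (n₀ + s) ω).1 ∈ T} + μ {ω | (ω, (ξ (n₀ + s) ω).1) ∈ E} +
          μ {ω | r < risk D l (h s ω) - optRisk D l H} :=
        (measure_union_le _ _).trans (add_le_add_left (measure_union_le _ _) _)
    _ = _ := by rw [hnull, add_zero, hTm]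

/-- The expected number of labels, from bounds on the probabilities to be near degeneracy. -/
theorem integral_labelCount_le [IsProbabilityMeasure μ] [IsProbabilityMeasure D]
    (run : IsRun μ ℱ D N S H l p n₀ b ξ q h) (hp : 0 ≤ p) {δ : ℝ} {ψ : ℕ → ℝ}
    (hδ : 0 ≤ δ) (hψ : ∀ s, 0 ≤ ψ s)
    (hnear : ∀ s, μ {ω | IsNear N S n₀ b ξ h s ω} ≤ ENNReal.ofReal (ψ s) + ENNReal.ofReal δ)
    (T : ℕ) :
    Integrable (fun ω => (labelCount N S n₀ b ξ q h T ω : ℝ)) μ ∧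
      ∫ ω, (labelCount N S n₀ b ξ q h T ω : ℝ) ∂μ ≤
        p * T + ∑ t ∈ Finset.Icc 1 T, ψ (t - 1) + δ * T := by
  have hmeas : ∀ s, MeasurableSet {ω | IsNear N S n₀ b ξ h s ω ∨ q s ω = true} := fun s =>
    (run.measurableSet_isNear s).union ((run.measurable_coin s) (measurableSet_singleton true))
  have hint : ∀ s, Integrable
      ({ω | IsNear N S n₀ b ξ h s ω ∨ q s ω = true}.indicator (1 : Ω → ℝ)) μ := fun s =>
    (integrable_const (1 : ℝ)).indicator (hmeas s)
  simp only [labelCount_eq_sum]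
  refine ⟨integrable_finsetSum _ fun s _ => hint s, ?_⟩
  rw [integral_finsetSum _ fun s _ => hint s]
  have hle : ∀ s, ∫ ω, {ω | IsNear N S n₀ b ξ h s ω ∨ q s ω = true}.indicator (1 : Ω → ℝ) ω ∂μ ≤
      p + ψ s + δ := by
    intro s
    rw [integral_indicator_one (hmeas s), measureReal_def]
    refine ENNReal.toReal_le_of_le_ofReal (by have := hψ s; positivity) ?_
    refine (measure_union_le {ω | IsNear N S n₀ b ξ h s ω} {ω | q s ω = true}).trans ?_
    rw [run.coin, ENNReal.ofReal_add (by have := hψ s; positivity) hδ,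
      ENNReal.ofReal_add hp (hψ s)]
    calc _ ≤ ENNReal.ofReal (ψ s) + ENNReal.ofReal δ + ENNReal.ofReal p := by
          gcongr
          exact hnear s
      _ = _ := by ring
  refine (Finset.sum_le_sum fun s _ => hle s).trans (le_of_eq ?_)
  induction T with
  | zero => simp
  | succ T ih =>
    rw [Finset.sum_range_succ, ih, Finset.sum_Icc_succ_top (by omega)]
    push_cast [Nat.add_sub_cancel]
    ring

end IsRun

end Labels

/-! ### Thresholds and radii -/

section Radius

variable {k d : ℕ} {X : Set (Fin k → ℝ)} {C : Set (Fin d → ℝ)} {H : Set (Predictor X d)}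
  {l : (Fin d → ℝ) → (Fin d → ℝ) → ℝ} {p δ : ℝ} {n₀ : ℕ}

theorem threshold_pos (hn₀ : 1 ≤ n₀) {b₀ : ℝ} (hb₀ : 0 < b₀) (t : ℕ) : 0 < threshold n₀ b₀ t := by
  unfold threshold
  split_ifs with h
  · exact hb₀
  · have ht : 0 < (t : ℝ) := by exact_mod_cast Nat.pos_of_ne_zero h
    have hn : 1 ≤ (n₀ : ℝ) := by exact_mod_cast hn₀
    have hlog : 0 < Real.log (n₀ + t) := Real.log_pos (by linarith)
    positivity

theorem threshold_eq_mul (n₀ : ℕ) (b₀ : ℝ) (t : ℕ) :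
    threshold n₀ b₀ t = b₀ * threshold n₀ 1 t := by
  unfold threshold
  split_ifs <;> simp

theorem radius_nonneg (hl : ∀ a c, 0 ≤ l a c) (hp : 0 < p) (t : ℕ) :
    0 ≤ radius C p δ l H n₀ t := by
  have := lossSup_nonneg (C := C) hl (predictionSpace H)
  unfold radius
  positivity

theorem fixedRadius_nonneg (hl : ∀ a c, 0 ≤ l a c) (hp : 0 < p) (t : ℕ) :
    0 ≤ fixedRadius C p δ l H n₀ t := by
  have := lossSup_nonneg (C := C) hl (predictionSpace H)
  unfold fixedRadius
  positivity

/-- The radius has order `√(ln n / n)`, so that `φ` at the radius has order `(ln n / n) ^ (1 / 4)`,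
the order of the thresholds. -/
theorem exists_radius_le (hl : ∀ a c, 0 ≤ l a c) (hδ : 0 < δ) (hδ1 : δ ≤ 1) (hp : 0 < p)
    (hn₀ : 1 ≤ n₀)
    (hK : ∃ K : ℝ, ∀ n ≥ n₀, Real.log (coverNum C p l H n).toNat ≤ K * Real.log (n + 1)) :
    ∃ A : ℝ, 0 ≤ A ∧ ∀ t ≥ 1, radius C p δ l H n₀ t ≤
      A * √(Real.log (t + n₀ : ℕ) / (t + n₀ : ℕ)) := by
  obtain ⟨K, hK⟩ := hK
  have hw := lossSup_nonneg (C := C) hl (predictionSpace H)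
  set w := lossSup l (predictionSpace H) C with hwdef
  have hlog2 : 0 < Real.log 2 := Real.log_pos (by norm_num)
  have hlogδ : 0 ≤ Real.log (2 / δ) := Real.log_nonneg (by rw [le_div_iff₀ hδ]; linarith)
  -- The three terms absorb `log (2 / δ)`, through `log n ≥ log 2`, then `log n`, and the covering
  -- number, through `n + 1 ≤ n ^ 2`. All this needs `n ≥ 2`, hence `t ≥ 1`.
  set A₀ : ℝ := Real.log (2 / δ) / Real.log 2 + 1 + 2 * |K| with hA₀
  have hA₀0 : 0 ≤ A₀ := by positivity
  refine ⟨2 * w * ((1 / p) * √(4 * A₀) + 4), by positivity, fun t ht => ?_⟩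
  set n := t + n₀ with hn
  have hn2 : (2 : ℝ) ≤ n := by
    have : 2 ≤ n := by omega
    exact_mod_cast this
  have hnpos : (0 : ℝ) < n := by linarith
  have hlogn : Real.log 2 ≤ Real.log n := Real.log_le_log (by norm_num) hn2
  have hlognpos : 0 < Real.log n := hlog2.trans_le hlogn
  have h1 : Real.log (2 * n * (coverNum C p l H n).toNat / δ) ≤ A₀ * Real.log n := by
    rcases Nat.eq_zero_or_pos (coverNum C p l H n).toNat with h0 | h0
    · rw [h0]
      simp only [CharP.cast_eq_zero, mul_zero, zero_div, Real.log_zero]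
      positivity
    have hm : (0 : ℝ) < (coverNum C p l H n).toNat := by exact_mod_cast h0
    have hsplit : 2 * n * (coverNum C p l H n).toNat / δ =
        2 / δ * n * (coverNum C p l H n).toNat := by ring
    rw [hsplit, Real.log_mul (by positivity) hm.ne', Real.log_mul (by positivity) hnpos.ne']
    have h2 : Real.log (2 / δ) ≤ Real.log (2 / δ) / Real.log 2 * Real.log n := by
      rw [div_mul_eq_mul_div, le_div_iff₀ hlog2]
      gcongr
    have h3 : Real.log ((n : ℝ) + 1) ≤ 2 * Real.log n := by
      rw [← Real.log_rpow hnpos]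
      refine Real.log_le_log (by positivity) ?_
      norm_num
      nlinarith
    have h4 : K * Real.log ((n : ℝ) + 1) ≤ 2 * |K| * Real.log n := by
      calc K * Real.log ((n : ℝ) + 1) ≤ |K| * Real.log ((n : ℝ) + 1) := by
            have : 0 ≤ Real.log ((n : ℝ) + 1) := Real.log_nonneg (by linarith)
            gcongr
            exact le_abs_self K
        _ ≤ |K| * (2 * Real.log n) := by gcongr
        _ = _ := by ring
    have h5 := hK n (by omega)
    rw [hA₀]
    nlinarith
  have h6 : √(4 * Real.log (2 * n * (coverNum C p l H n).toNat / δ) / n) ≤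
      √(4 * A₀) * √(Real.log n / n) := by
    rw [← Real.sqrt_mul (by positivity)]
    refine Real.sqrt_le_sqrt ?_
    rw [mul_div_assoc']
    refine div_le_div_of_nonneg_right ?_ hnpos.le
    linarith
  have h7 : 2 / (n : ℝ) ≤ 4 * √(Real.log n / n) := by
    have h8 : 1 / (2 * (n : ℝ)) ≤ √(Real.log n / n) := by
      refine Real.le_sqrt_of_sq_le ?_
      rw [div_pow, one_pow, div_le_div_iff₀ (by positivity) hnpos]
      have : (1 : ℝ) / 4 ≤ Real.log n := by linarith [Real.log_two_gt_d9]
      nlinarith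
    have h9 : 2 / (n : ℝ) = 4 * (1 / (2 * (n : ℝ))) := by
      field_simp
      norm_num
    rw [h9]
    gcongr
  calc radius C p δ l H n₀ t = 2 * w * ((1 / p) *
        √(4 * Real.log (2 * n * (coverNum C p l H n).toNat / δ) / n) + 2 / n) := rfl
    _ ≤ 2 * w * ((1 / p) * (√(4 * A₀) * √(Real.log n / n)) + 4 * √(Real.log n / n)) := by gcongr
    _ = _ := by ring

/-- The threshold has an extra factor `n₀ ≥ 1` and the smaller denominator `t ≤ t + n₀`; both only
enlarge it. -/
theorem sqrt_sqrt_le_threshold (hn₀ : 1 ≤ n₀) {t : ℕ} (ht : 1 ≤ t) :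
    √(√(Real.log (t + n₀ : ℕ) / (t + n₀ : ℕ))) ≤ threshold n₀ 1 t := by
  have ht' : (1 : ℝ) ≤ t := by exact_mod_cast ht
  have hn' : (1 : ℝ) ≤ n₀ := by exact_mod_cast hn₀
  have hlog : 0 < Real.log (n₀ + t) := Real.log_pos (by linarith)
  have e : √(√(Real.log (t + n₀ : ℕ) / (t + n₀ : ℕ))) =
      (Real.log (n₀ + t) / (n₀ + t)) ^ (1 / 4 : ℝ) := by
    rw [Real.sqrt_eq_rpow, Real.sqrt_eq_rpow, ← Real.rpow_mul]
    · push_cast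
      rw [add_comm (t : ℝ)]
      norm_num
    · push_cast
      rw [add_comm (t : ℝ)]
      positivity
  rw [e, threshold, if_neg (by omega), one_mul]
  refine Real.rpow_le_rpow (by positivity) ?_ (by norm_num)
  calc Real.log (n₀ + t) / (n₀ + t) ≤ Real.log (n₀ + t) / t := by
        gcongr
        linarith
    _ ≤ n₀ * Real.log (n₀ + t) / t := by
        gcongr
        nlinarith

/-- If the logarithmic covering numbers grow logarithmically, large thresholds dominate `φ` at the
radii. -/
theorem exists_forall_two_mul_le_threshold (hl : ∀ a c, 0 ≤ l a c) (hδ : 0 < δ) (hδ1 : δ ≤ 1)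
    (hp : 0 < p) (hn₀ : 1 ≤ n₀)
    (hK : ∃ K : ℝ, ∀ n ≥ n₀, Real.log (coverNum C p l H n).toNat ≤ K * Real.log (n + 1))
    {φ : ℝ → ℝ} (hφ0 : φ 0 = 0) (hφ : φ =O[𝓝[>] 0] Real.sqrt) :
    ∃ B : ℝ, ∀ b₀ ≥ B, ∀ t, 2 * φ (radius C p δ l H n₀ t) ≤ threshold n₀ b₀ t := by
  have hτ := fun t => threshold_pos hn₀ one_pos t
  rcases (lossSup_nonneg (C := C) hl (predictionSpace H)).eq_or_lt with hω | hω
  · refine ⟨0, fun b₀ hb₀ t => ?_⟩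
    have : radius C p δ l H n₀ t = 0 := by simp [radius, ← hω]
    rw [this, hφ0, mul_zero, threshold_eq_mul]
    exact mul_nonneg hb₀ (hτ t).le
  obtain ⟨A, hA, hrad⟩ := exists_radius_le hl hδ hδ1 hp hn₀ hK
  set ρ : ℕ → ℝ := fun t => radius C p δ l H n₀ t with hρ
  have hρpos : ∀ t, 0 < ρ t := by
    intro t
    have : 0 < ((t + n₀ : ℕ) : ℝ) := by
      have : 0 < t + n₀ := by omega
      exact_mod_cast this
    simp only [hρ, radius]
    positivity
  have hlim0 : Tendsto (fun n : ℕ => Real.log n / n) atTop (𝓝 0) := by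
    have := (Real.tendsto_pow_log_div_mul_add_atTop 1 0 1 one_ne_zero).comp
      tendsto_natCast_atTop_atTop
    simpa [Function.comp_def] using this
  have hlim1 : Tendsto (fun t : ℕ => A * √(Real.log (t + n₀ : ℕ) / (t + n₀ : ℕ))) atTop (𝓝 0) := by
    have h1 := hlim0.comp (tendsto_add_atTop_nat n₀)
    have h2 := ((Real.continuous_sqrt.tendsto 0).comp h1).const_mul A
    simpa [Function.comp_def] using h2
  have hlim : Tendsto ρ atTop (𝓝[>] 0) := by
    refine tendsto_nhdsWithin_iff.2 ⟨?_, Eventually.of_forall hρpos⟩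
    refine tendsto_of_tendsto_of_tendsto_of_le_of_le' tendsto_const_nhds hlim1
      (Eventually.of_forall fun t => (hρpos t).le) ?_
    filter_upwards [eventually_ge_atTop 1] with t ht using hrad t ht
  have hO : (fun t => φ (ρ t)) =O[atTop] fun t => threshold n₀ 1 t := by
    refine (hφ.comp_tendsto hlim).trans (Asymptotics.IsBigO.of_bound (√A) ?_)
    filter_upwards [eventually_ge_atTop 1] with t ht
    simp only [Function.comp_apply]
    rw [Real.norm_of_nonneg (Real.sqrt_nonneg _), Real.norm_of_nonneg (hτ t).le]
    calc √(ρ t) ≤ √(A * √(Real.log (t + n₀ : ℕ) / (t + n₀ : ℕ))) := Real.sqrt_le_sqrt (hrad t ht)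
      _ = √A * √(√(Real.log (t + n₀ : ℕ) / (t + n₀ : ℕ))) := Real.sqrt_mul hA _
      _ ≤ _ := by
        gcongr
        exact sqrt_sqrt_le_threshold hn₀ ht
  -- The thresholds are positive at every `t`, so the asymptotic bound holds for all `t` with a
  -- larger constant. Linearity in `b₀` then lets `b₀` absorb it.
  obtain ⟨B, hB, hbound⟩ := Asymptotics.bound_of_isBigO_nat_atTop hO
  refine ⟨2 * B, fun b₀ hb₀ t => ?_⟩
  have h1 := hbound (hτ t).ne'
  rw [Real.norm_of_nonneg (hτ t).le] at h1
  rw [threshold_eq_mul]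
  have h2 := (le_abs_self _).trans h1
  have h3 := mul_le_mul_of_nonneg_right hb₀ (hτ t).le
  simp only [hρ] at h2
  linarith

end Radius

end

end MBAL

theorem theorem2 {k d : ℕ}
    -- the feature space, the cost vector space and the distribution of the pairs
    (X : Set (Fin k → ℝ)) (hX : MeasurableSet X)
    (C : Set (Fin d → ℝ)) (hC : MeasurableSet C) (hCb : Bornology.IsBounded C)
    (D : Measure (X × C)) [IsProbabilityMeasure D]
    -- the norm on the cost vectors, the feasible polyhedron and the optimization oracle
    (N : Seminorm ℝ (Fin d → ℝ)) (hN : ∀ c, N c = 0 → c = 0)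
    (S : Set (Fin d → ℝ)) (hS : MBAL.IsPolyhedron S)
    (w : (Fin d → ℝ) → (Fin d → ℝ)) (hw : ∀ c, w c ∈ MBAL.optimalSolutions S c)
    (hwm : Measurable w)
    -- the hypothesis class, compact for uniform convergence
    (H : Set (MBAL.Predictor X d)) (hHm : ∀ g ∈ H, Measurable g)
    (hHc : IsCompact {f : X →ᵤ (Fin d → ℝ) | UniformFun.toFun f ∈ H})
    -- the surrogate loss
    (l : (Fin d → ℝ) → (Fin d → ℝ) → ℝ) (hl : ∀ a c, 0 ≤ l a c)
    (hlm : Measurable (Function.uncurry l))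
    (hlb : BddAbove (Set.image2 l (MBAL.predictionSpace H) C))
    -- consistency
    (hne : (MBAL.minimizers D l H).Nonempty)
    (hcons : MBAL.minimizers D l H ⊆ MBAL.minimizers D (MBAL.spoLoss w) H)
    -- error bound, with `φ(ε) = O(√ε)`
    (φ : ℝ → ℝ) (hφm : MonotoneOn φ (Set.Ici 0)) (hφ0 : φ 0 = 0)
    (hφ : φ =O[𝓝[>] 0] Real.sqrt)
    (herr : ∀ g ∈ H, ∀ ε > 0, MBAL.risk D l g - MBAL.optRisk D l H ≤ ε →
      MBAL.distTo N D (MBAL.minimizers D l H) g ≤ ENNReal.ofReal (φ ε))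
    -- the parameters; the covering numbers in the radii are finite
    (δ p : ℝ) (hδ : 0 < δ) (hδ1 : δ ≤ 1) (hp : 0 < p) (hp1 : p ≤ 1)
    (n₀ : ℕ) (hn₀ : 1 ≤ n₀)
    (hfin : ∀ n ≥ n₀, MBAL.coverNum C p l H n ≠ ⊤) :
    -- if the logarithmic covering numbers are `O(ln n)`, every large `b₀` is large enough
    ((∃ K : ℝ, ∀ n ≥ n₀,
        Real.log (MBAL.coverNum C p l H n).toNat ≤ K * Real.log (n + 1)) →
      ∃ B : ℝ, ∀ b₀ ≥ B, ∀ t,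
        2 * φ (MBAL.radius C p δ l H n₀ t) ≤ MBAL.threshold n₀ b₀ t) ∧
    -- the guarantees for every run of the algorithm
    (∀ b₀ > 0, ∀ {Ω : Type*} [mΩ : MeasurableSpace Ω] (μ : Measure Ω) [IsProbabilityMeasure μ]
      (ℱ : Filtration ℕ mΩ) (ξ : ℕ → Ω → X × C) (q : ℕ → Ω → Bool)
      (h : ℕ → Ω → MBAL.Predictor X d),
      MBAL.IsRun μ ℱ D N S H l p n₀ (MBAL.threshold n₀ b₀) ξ q h →
      -- simultaneously for all `T`, outside an event of probability at most `δ`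
      ((∀ t, 2 * φ (MBAL.radius C p δ l H n₀ t) ≤ MBAL.threshold n₀ b₀ t) →
        μ {ω | ¬ ∀ T ≥ 1,
            MBAL.risk D l (h T ω) - MBAL.optRisk D l H ≤ MBAL.radius C p δ l H n₀ T ∧
            MBAL.risk D (MBAL.spoLoss w) (h T ω) - MBAL.optRisk D (MBAL.spoLoss w) H ≤
              MBAL.nearDegeneracy N S D (MBAL.minimizers D (MBAL.spoLoss w) H)
                (2 * MBAL.threshold n₀ b₀ T) * MBAL.linGapSup S C}
          ≤ ENNReal.ofReal δ ∧
        ∀ T ≥ 1,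
          Integrable (fun ω =>
            (MBAL.labelCount N S n₀ (MBAL.threshold n₀ b₀) ξ q h T ω : ℝ)) μ ∧
          ∫ ω, (MBAL.labelCount N S n₀ (MBAL.threshold n₀ b₀) ξ q h T ω : ℝ) ∂μ ≤
            p * T + ∑ t ∈ Finset.Icc 1 T,
              MBAL.nearDegeneracy N S D (MBAL.minimizers D (MBAL.spoLoss w) H)
                (2 * MBAL.threshold n₀ b₀ (t - 1)) + δ * T) ∧
      -- the same with the smaller radius, at every fixed `T`
      ((∀ t, 2 * φ (MBAL.fixedRadius C p δ l H n₀ t) ≤ MBAL.threshold n₀ b₀ t) →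
        ∀ T ≥ 1,
          μ {ω | ¬ (
              MBAL.risk D l (h T ω) - MBAL.optRisk D l H ≤ MBAL.fixedRadius C p δ l H n₀ T ∧
              MBAL.risk D (MBAL.spoLoss w) (h T ω) - MBAL.optRisk D (MBAL.spoLoss w) H ≤
                MBAL.nearDegeneracy N S D (MBAL.minimizers D (MBAL.spoLoss w) H)
                  (2 * MBAL.threshold n₀ b₀ T) * MBAL.linGapSup S C)}
            ≤ ENNReal.ofReal δ ∧
          Integrable (fun ω =>
            (MBAL.labelCount N S n₀ (MBAL.threshold n₀ b₀) ξ q h T ω : ℝ)) μ ∧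
          ∫ ω, (MBAL.labelCount N S n₀ (MBAL.threshold n₀ b₀) ξ q h T ω : ℝ) ∂μ ≤
            p * T + ∑ t ∈ Finset.Icc 1 T,
              MBAL.nearDegeneracy N S D (MBAL.minimizers D (MBAL.spoLoss w) H)
                (2 * MBAL.threshold n₀ b₀ (t - 1)) + δ * T)) := by
  have hspo : ∀ g ∈ H, ∀ r b : ℝ, 0 ≤ r → 0 < b → 2 * φ r ≤ b →
      MBAL.risk D l g - MBAL.optRisk D l H ≤ r →
      MBAL.risk D (MBAL.spoLoss w) g - MBAL.optRisk D (MBAL.spoLoss w) H ≤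
        MBAL.nearDegeneracy N S D (MBAL.minimizers D (MBAL.spoLoss w) H) (2 * b) *
          MBAL.linGapSup S C := by
    intro g hg r b hr hb hφr hgr
    obtain ⟨g', hg', hae⟩ := MBAL.exists_minimizer_near hφ herr hg hr hb hφr hgr
    exact MBAL.risk_spoLoss_sub_le hS hw hwm hCb hHm hg (hcons hg') hb hae
  refine ⟨fun hK => MBAL.exists_forall_two_mul_le_threshold hl hδ hδ1 hp hn₀ hK hφ0 hφ, ?_⟩
  intro b₀ hb₀ Ω mΩ μ hμ ℱ ξ q h run
  have hb : ∀ t, 0 < MBAL.threshold n₀ b₀ t := MBAL.threshold_pos hn₀ hb₀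
  have hlabel : ∀ r : ℕ → ℝ, (∀ t, 0 ≤ r t) →
      (∀ t, 2 * φ (r t) ≤ MBAL.threshold n₀ b₀ t) →
      (∀ t, μ {ω | r t < MBAL.risk D l (h t ω) - MBAL.optRisk D l H} ≤ ENNReal.ofReal δ) →
      ∀ T, Integrable (fun ω =>
          (MBAL.labelCount N S n₀ (MBAL.threshold n₀ b₀) ξ q h T ω : ℝ)) μ ∧
        ∫ ω, (MBAL.labelCount N S n₀ (MBAL.threshold n₀ b₀) ξ q h T ω : ℝ) ∂μ ≤
          p * T + ∑ t ∈ Finset.Icc 1 T,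
            MBAL.nearDegeneracy N S D (MBAL.minimizers D (MBAL.spoLoss w) H)
              (2 * MBAL.threshold n₀ b₀ (t - 1)) + δ * T := by
    intro r hr hφr hbad T
    refine run.integral_labelCount_le hp.le (ψ := fun s => MBAL.nearDegeneracy N S D
      (MBAL.minimizers D (MBAL.spoLoss w) H) (2 * MBAL.threshold n₀ b₀ s)) hδ.le
      (fun s => measureReal_nonneg) (fun s => ?_) T
    refine (run.measure_isNear_le (H' := MBAL.minimizers D (MBAL.spoLoss w) H) hlm (hb s)
      (r := r s) fun g hg hgr => ?_).trans (by gcongr; exact hbad s)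
    obtain ⟨g', hg', hae⟩ := MBAL.exists_minimizer_near hφ herr hg (hr s) (hb s) (hφr s) hgr
    exact ⟨g', hcons hg', hae⟩
  constructor
  · intro hφr
    have hr : ∀ t, 0 ≤ MBAL.radius C p δ l H n₀ t := MBAL.radius_nonneg hl hp
    have hbad := run.measure_radius_lt hX hC hHm hHc hne hl hlm hlb hp hp1 hδ hδ1 hn₀ hfin
    constructor
    -- No claim is made at `T = 0`, and the dominating series is zero there since `1 / 0 = 0`; hence
    -- the empty set.
    · let u : ℕ → Set Ω := fun T => if 1 ≤ T then
        {ω | MBAL.radius C p δ l H n₀ T < MBAL.risk D l (h T ω) - MBAL.optRisk D l H} else ∅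
      have hu : ∀ T, μ (u T) ≤ ENNReal.ofReal (δ / 2 * (1 / (T : ℝ) ^ 2)) := by
        intro T
        by_cases hT : 1 ≤ T
        · simp only [u, if_pos hT]
          refine (hbad T).trans (ENNReal.ofReal_le_ofReal ?_)
          have hT' : (0 : ℝ) < T := by exact_mod_cast hT
          gcongr
          omega
        · simp [u, if_neg hT]
      refine (measure_mono fun ω hω => ?_).trans ((measure_iUnion_le u).trans
        ((ENNReal.tsum_le_tsum hu).trans (MBAL.tsum_ofReal_half_mul_inv_sq_le hδ)))
      by_contra hcon
      refine hω fun T hT => ?_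
      have h1 : MBAL.risk D l (h T ω) - MBAL.optRisk D l H ≤ MBAL.radius C p δ l H n₀ T := by
        by_contra hlt
        refine hcon (Set.mem_iUnion.2 ⟨T, ?_⟩)
        simp only [u, if_pos hT]
        exact not_le.1 hlt
      exact ⟨h1, hspo _ (run.pred_mem T ω) _ _ (hr T) (hb T) (hφr T) h1⟩
    · intro T _
      -- The label bound uses the failure probability of each iteration separately, including `t =
      -- 0`, so no union bound enters and `δ` per iteration suffices.
      refine hlabel _ hr hφr (fun t => (hbad t).trans (ENNReal.ofReal_le_ofReal ?_)) T
      have h1 : (1 : ℝ) ≤ ((t + n₀ : ℕ) : ℝ) ^ 2 := by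
        have : 1 ≤ (t + n₀) ^ 2 := Nat.one_le_pow _ _ (by omega)
        exact_mod_cast this
      have h2 : 1 / ((t + n₀ : ℕ) : ℝ) ^ 2 ≤ 1 := (div_le_one (by positivity)).2 h1
      nlinarith
  · intro hφr T _
    have hr : ∀ t, 0 ≤ MBAL.fixedRadius C p δ l H n₀ t := MBAL.fixedRadius_nonneg hl hp
    have hbad := run.measure_fixedRadius_lt hX hC hHm hHc hne hl hlm hlb hp hp1 hδ hδ1 hn₀ hfin
    -- The SPO bound follows from the surrogate bound at the same `T`, so one failure event covers
    -- both.
    refine ⟨(measure_mono fun ω hω => ?_).trans (hbad T), hlabel _ hr hφr hbad T⟩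
    by_contra hlt
    have h1 : MBAL.risk D l (h T ω) - MBAL.optRisk D l H ≤ MBAL.fixedRadius C p δ l H n₀ T :=
      not_lt.1 hlt
    exact hω ⟨h1, hspo _ (run.pred_mem T ω) _ _ (hr T) (hb T) (hφr T) h1⟩
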